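/- For integers $b,c$ and $n\ge 0$ let $T_n(b,c)=[x^n](x^2+bx+c)^n$ be the generalized central trinomial coefficient and $M_n(b,c)=\sum_{k=0}^{\lfloor n/2\rfloor}\binom{n}{2k}C_k\,b^{n-2k}c^k$ the generalized Motzkin number, where $C_k=\frac1{k+1}\binom{2k}{k}$ is the $k$-th Catalan number. For $1\le k\le n$ put $w(n,k)=\frac1k\binom{n-1}{k-1}\binom{n+k}{k-1}$. For a prime $p$ and an integer $a$ not divisible by $p$ let $q_p(a)=(a^{p-1}-1)/p$ be the Fermat quotient; $\left(\frac{\cdot}{p}\right)$ denotes the Legendre symbol and $F_m$ the $m$-th Fibonacci number. A congruence $x\equiv y \pmod{p^m}$ between rational numbers means that $(x-y)/p^m$ is a rational number whose denominator is prime to $p$. Then for every integer $n\ge1$, $$\frac1n\sum_{k=0}^{n-1}T_k(1,-1)M_k(1,-1)5^{n-1-k}=\sum_{k=1}^n(-1)^{k-1}w(n,k)C_{k-1}5^{n-k}\in\mathbb Z$$ and $$\frac1n\sum_{k=0}^{n-1}\frac{T_k(5,5)M_k(5,5)}{5^k}=\sum_{k=1}^nw(n,k)C_{k-1}\in\mathbb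 Z.$$ Moreover, for every prime $p\ne2,5$, $$\sum_{k=0}^{p-1}\frac{T_k(1,-1)M_k(1,-1)}{5^k}\equiv\frac p2\left(1-\left(\frac p5\right)\right)+\frac{p^2}2\left(5-\left(\frac p5\right)-q_p(5)\right)+\frac p2\left(5-2\left(\frac p5\right)\right)F_{p-\left(\frac p5\right)}\pmod{p^3},$$ $$\sum_{k=0}^{p-1}\frac{T_k(5,5)M_k(5,5)}{5^k}\equiv\frac{5p}2\left(\left(\frac p5\right)-1\right)+\frac{p^2}2\left(5\left(\frac p5\right)-1\right)-\frac{5p}2\left(1+2\left(\frac p5\right)\right)F_{p-\left(\frac p5\right)}\pmod{p^3},$$ and $$\left(\frac{-5}p\right)\sum_{k=0}^{p-1}\frac{kT_k(1,-1)M_k(1,-1)}{5^k}\equiv\sum_{k=0}^{p-1}\frac{kT_k(5,5)M_k(5,5)}{5^k}\equiv2\pmod p.$$ -/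

import Mathlib

namespace TrinomialMotzkin

/-- `5` is prime, so that the Legendre symbol `legendreSym 5 a` can be written. -/
instance fact_prime_five : Fact (Nat.Prime 5) := ⟨by norm_num⟩

open Polynomial in
/-- The generalized central trinomial coefficient `T_n(b,c)`: the coefficient of `x^n` in the
expansion of `(x^2 + b x + c)^n`. -/
noncomputable def T (n : ℕ) (b c : ℤ) : ℤ :=
  ((X ^ 2 + C b * X + C c : ℤ[X]) ^ n).coeff n

/-- The generalized Motzkin number
`M_n(b,c) = ∑_{k=0}^{⌊n/2⌋} binom(n,2k) C_k b^{n-2k} c^k`, where `C_k` is the `k`-th Catalan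
number. -/
def M (n : ℕ) (b c : ℤ) : ℤ :=
  ∑ k ∈ Finset.range (n / 2 + 1), (n.choose (2 * k) : ℤ) * (catalan k : ℤ) * b ^ (n - 2 * k) * c ^ k

/-- `w(n,k) = (1/k) binom(n-1,k-1) binom(n+k,k-1)`, for `1 ≤ k ≤ n`, as a rational number. -/
def w (n k : ℕ) : ℚ :=
  1 / (k : ℚ) * ((n - 1).choose (k - 1) : ℚ) * ((n + k).choose (k - 1) : ℚ)

/-- The Fermat quotient `q_p(a) = (a^{p-1} - 1) / p`, as a rational number. -/
def fermatQuotient (p : ℕ) (a : ℤ) : ℚ :=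
  ((a : ℚ) ^ (p - 1) - 1) / (p : ℚ)

/-- Congruence `x ≡ y (mod p^m)` of rational numbers at the prime `p`: the difference is `p^m`
times a `p`-integral rational number (one whose denominator in lowest terms is prime to `p`). -/
def CongrModPow (p m : ℕ) (x y : ℚ) : Prop :=
  ∃ r : ℚ, ¬ p ∣ r.den ∧ x - y = (p : ℚ) ^ m * r

/-- The index `p - (p/5)` of the Fibonacci number; it is at least `p - 1`, so nonnegative. -/
def fibIndex (p : ℕ) : ℕ :=
  ((p : ℤ) - legendreSym 5 (p : ℤ)).toNat

end TrinomialMotzkin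

namespace TrinomialMotzkin

open Finset Polynomial

/-! Put `d = b² - 4c`. Up to the factor `d^(n/2)`, `T_n` is a Legendre polynomial at `b/√d`, and the
square of a Legendre polynomial has the explicit coefficients `sqCoeff` in powers of `c/d`. `T_n`
and `n M_{n-1}` satisfy a first-order linear system, so the three products `T_n²`, `n T_n M_{n-1}`,
`(n M_{n-1})²` satisfy one too, and `products_eq_eval` solves it in closed form. Since `(n+2) M_n`
is a combination of `T_n` and `n M_{n-1}`, the sum of `T_k M_k / d^k` telescopes:
`sum_T_mul_M_div_pow` writes it as `∑ n w(n,k+1) C_k (c/d)^k`. Both pairs `(1,-1)` and `(5,5)` have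
`d = 5`, with `c/d = -1/5` and `1`. The numbers `w(n,k)` are integers because `n w` and `(n+1) w`
are.

For `n = p = 2m+1` the sum has an explicit factor `p`, so a congruence modulo `p³` becomes one
modulo `p²` for `∑ w(p,k+1) C_k x^k`. There `w(p,k+1) ≡ (1-p)(-1)^k + binom(p,k+1)` for `k < p-1`
(`cast_wInt_prime`), which leaves two kinds of sums. Geometric sums of Catalan numbers are needed
modulo `p²`: `sum_catalan_mul_pow` turns them into binomial transforms of Fibonacci and Lucas
sequences. Sums of `binom(p,k+1)/p · C_k` are needed only modulo `p`: there `-2 C_k` is `(-4)^(k+1)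
binom(1/2,k+1)` with `1/2 = m+1`, and the sums reduce to the even and odd parts of `(1+√5)^p`. What
remains involves only `F_p`, `L_p`, `5^m` and `2^(p-1)`; `prime_expansions` and a nilpotent
computation finish.

For the sums weighted by `k`, Abel summation gives minus the sum over `n < p` of the partial sums.
Modulo `p`, the coefficient of `(c/d)^k` in it is a sum over all residues of a polynomial in `n`, of
degree below `p-1` if `k < m`, and it vanishes for `k > m` because `p` divides each contributing
Catalan number. Only `k = m` survives, giving `2 (c/d)^m`. -/

/-! ### Binomial sums and the linear system for trinomial and Motzkin numbers -/

theorem sum_range_two_mul {R : Type*} [AddCommMonoid R] (f : ℕ → R) (L : ℕ) :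
    ∑ m ∈ range (2 * L), f m = ∑ k ∈ range L, (f (2 * k) + f (2 * k + 1)) := by
  induction L with
  | zero => simp
  | succ L ih =>
    rw [Finset.sum_range_succ, ← ih, show 2 * (L + 1) = 2 * L + 1 + 1 by ring,
      Finset.sum_range_succ, Finset.sum_range_succ, add_assoc]

theorem coeff_X_sq_add_C_pow (c : ℤ) (m : ℕ) :
    ((X ^ 2 + C c : ℤ[X]) ^ m).coeff m
      = if 2 ∣ m then c ^ (m - m / 2) * (m.choose (m / 2) : ℤ) else 0 := by
  have h : (X ^ 2 + C c : ℤ[X]) ^ m = expand ℤ 2 ((X + C c) ^ m) := by simp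
  rw [h, coeff_expand two_pos, coeff_X_add_C_pow]

theorem T_eq_sum (n : ℕ) (b c : ℤ) :
    T n b c = ∑ k ∈ range (n + 1),
      (n.choose (2 * k) : ℤ) * (k.centralBinom : ℤ) * b ^ (n - 2 * k) * c ^ k := by
  let f : ℕ → ℤ := fun m => b ^ (n - m) * ((X ^ 2 + C c : ℤ[X]) ^ m).coeff m * (n.choose m : ℤ)
  have h1 : T n b c = ∑ m ∈ range (n + 1), f m := by
    -- Splitting off the middle term makes the other factor even in `X`, so only even `m`
    -- contribute.
    have : (X ^ 2 + C b * X + C c : ℤ[X]) = (X ^ 2 + C c) + C b * X := by ring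
    rw [T, this, add_pow, finsetSum_coeff]
    refine Finset.sum_congr rfl fun m hm => ?_
    have hm : m ≤ n := by simpa [Nat.lt_succ_iff] using hm
    have e : (X ^ 2 + C c : ℤ[X]) ^ m * (C b * X) ^ (n - m) * (n.choose m : ℤ[X])
        = C (b ^ (n - m) * (n.choose m : ℤ)) * ((X ^ 2 + C c : ℤ[X]) ^ m * X ^ (n - m)) := by
      rw [C_mul, C_pow, mul_pow, show C (n.choose m : ℤ) = (n.choose m : ℤ[X]) by simp]
      ring
    rw [e, coeff_C_mul, coeff_mul_X_pow', if_pos (Nat.sub_le _ _), Nat.sub_sub_self hm]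
    simp only [f]
    ring
  have h2 : ∑ m ∈ range (n + 1), f m = ∑ m ∈ range (2 * (n + 1)), f m := by
    refine Finset.sum_subset (by intro x; simp; omega) fun m _ hm => ?_
    have : n < m := by simpa using hm
    simp [f, Nat.choose_eq_zero_of_lt this]
  rw [h1, h2, sum_range_two_mul]
  refine Finset.sum_congr rfl fun k _ => ?_
  have e1 : ¬ 2 ∣ 2 * k + 1 := by omega
  have e2 : 2 * k / 2 = k := by omega
  have e3 : 2 * k - k = k := by omega
  simp only [f, coeff_X_sq_add_C_pow, e1, e2, e3, if_false, dvd_mul_right, if_true,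
    Nat.centralBinom_eq_two_mul_choose]
  ring

theorem M_eq_sum (n : ℕ) (b c : ℤ) :
    M n b c = ∑ k ∈ range (n + 1),
      (n.choose (2 * k) : ℤ) * (catalan k : ℤ) * b ^ (n - 2 * k) * c ^ k := by
  rw [M]
  refine Finset.sum_subset (by intro x; simp; omega) fun k _ hk => ?_
  have : n < 2 * k := by
    have : ¬ k < n / 2 + 1 := by simpa using hk
    omega
  simp [Nat.choose_eq_zero_of_lt this]

theorem centralBinom_eq_mul_catalan (k : ℕ) : k.centralBinom = (k + 1) * catalan k :=
  (succ_mul_catalan_eq_centralBinom k).symm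

theorem centralBinom_succ_eq_mul_catalan (k : ℕ) :
    (k + 1).centralBinom = 2 * (2 * k + 1) * catalan k := by
  have h := Nat.succ_mul_centralBinom_succ k
  rw [centralBinom_eq_mul_catalan k] at h
  exact Nat.eq_of_mul_eq_mul_left (Nat.succ_pos k) (by rw [Nat.succ_eq_add_one, h]; ring)

/-- The sequence `n M_{n-1}(b,c)`. -/
def shiftM (n : ℕ) (b c : ℤ) : ℤ := n * M (n - 1) b c

theorem shiftM_eq_sum (n : ℕ) (b c : ℤ) :
    shiftM n b c = ∑ k ∈ range n,
      (n.choose (2 * k + 1) : ℤ) * ((2 * k + 1) * (catalan k : ℤ)) * b ^ (n - 1 - 2 * k)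
        * c ^ k := by
  rcases n with _ | n
  · simp [shiftM]
  · rw [shiftM, Nat.add_sub_cancel, M_eq_sum, Finset.mul_sum]
    refine Finset.sum_congr rfl fun k _ => ?_
    have h : ((n + 1 : ℕ) : ℤ) * (n.choose (2 * k) : ℤ)
        = ((n + 1).choose (2 * k + 1) : ℤ) * (2 * k + 1) := by
      exact_mod_cast Nat.add_one_mul_choose_eq n (2 * k)
    linear_combination (catalan k : ℤ) * b ^ (n - 2 * k) * c ^ k * h

theorem choose_mul_pow_succ_sub (n j : ℕ) (b : ℤ) :
    (n.choose j : ℤ) * b ^ (n + 1 - j) = b * ((n.choose j : ℤ) * b ^ (n - j)) := by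
  rcases lt_or_ge n j with h | h
  · simp [Nat.choose_eq_zero_of_lt h]
  · rw [Nat.succ_sub h, pow_succ]; ring

/-- Pascal's rule on `binom(n+1, 2k+2)`: the odd-index part becomes `shiftM` through `centralBinom
(k+1) = 2(2k+1) C_k`. -/
theorem T_succ (n : ℕ) (b c : ℤ) : T (n + 1) b c = b * T n b c + 2 * c * shiftM n b c := by
  have hT : T n b c = ∑ k ∈ range (n + 2),
      (n.choose (2 * k) : ℤ) * (k.centralBinom : ℤ) * b ^ (n - 2 * k) * c ^ k := by
    rw [T_eq_sum, Finset.sum_range_succ _ (n + 1),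
      Nat.choose_eq_zero_of_lt (show n < 2 * (n + 1) by omega)]
    simp
  have hm : shiftM n b c = ∑ k ∈ range (n + 1),
      (n.choose (2 * k + 1) : ℤ) * ((2 * k + 1) * (catalan k : ℤ)) * b ^ (n - 1 - 2 * k)
        * c ^ k := by
    rw [shiftM_eq_sum, Finset.sum_range_succ _ n,
      Nat.choose_eq_zero_of_lt (show n < 2 * n + 1 by omega)]
    simp
  rw [T_eq_sum, hT, hm, Finset.sum_range_succ', Finset.sum_range_succ' _ (n + 1), mul_add,
    Finset.mul_sum, Finset.mul_sum, add_right_comm, ← Finset.sum_add_distrib]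
  congr 1
  · refine Finset.sum_congr rfl fun k _ => ?_
    have h1 : ((n + 1).choose (2 * (k + 1)) : ℤ)
        = (n.choose (2 * k + 1) : ℤ) + (n.choose (2 * (k + 1)) : ℤ) := by
      exact_mod_cast Nat.choose_succ_succ n (2 * k + 1)
    have h2 : ((k + 1).centralBinom : ℤ) = 2 * (2 * k + 1) * (catalan k : ℤ) := by
      exact_mod_cast centralBinom_succ_eq_mul_catalan k
    have h3 := choose_mul_pow_succ_sub n (2 * (k + 1)) b
    have h4 : n + 1 - 2 * (k + 1) = n - 1 - 2 * k := by omega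
    rw [h1, h2]
    rw [h4] at h3 ⊢
    linear_combination 2 * (2 * k + 1) * (catalan k : ℤ) * c ^ (k + 1) * h3
  · simp [pow_succ, mul_comm]

/-- Termwise, this is the splitting `n + 2 = 2(k+1) + (n-2k)`: the first part turns `C_k` into a
central binomial, the second moves `binom(n,2k)` to `binom(n,2k+1)`. -/
theorem add_two_mul_M (n : ℕ) (b c : ℤ) :
    ((n : ℤ) + 2) * M n b c = 2 * T n b c + b * shiftM n b c := by
  have hm : shiftM n b c = ∑ k ∈ range (n + 1),
      (n.choose (2 * k + 1) : ℤ) * ((2 * k + 1) * (catalan k : ℤ)) * b ^ (n - 1 - 2 * k)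
        * c ^ k := by
    rw [shiftM_eq_sum, Finset.sum_range_succ _ n,
      Nat.choose_eq_zero_of_lt (show n < 2 * n + 1 by omega)]
    simp
  rw [M_eq_sum, T_eq_sum, hm, Finset.mul_sum, Finset.mul_sum, Finset.mul_sum,
    ← Finset.sum_add_distrib]
  refine Finset.sum_congr rfl fun k _ => ?_
  have h2 : (k.centralBinom : ℤ) = (k + 1) * (catalan k : ℤ) := by
    exact_mod_cast centralBinom_eq_mul_catalan k
  have h3 := choose_mul_pow_succ_sub n (2 * k + 1) b
  have h4 : n + 1 - (2 * k + 1) = n - 2 * k := by omega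
  have h6 : n - (2 * k + 1) = n - 1 - 2 * k := by omega
  have h5 : (n.choose (2 * k + 1) : ℤ) * (2 * k + 1)
      = (n.choose (2 * k) : ℤ) * ((n : ℤ) - 2 * k) := by
    have := Nat.choose_succ_right_eq n (2 * k)
    rcases le_or_gt (2 * k) n with h | h
    · have h' : ((n - 2 * k : ℕ) : ℤ) = (n : ℤ) - 2 * k := by push_cast [h]; ring
      rw [← h']
      exact_mod_cast this
    · simp [Nat.choose_eq_zero_of_lt h, Nat.choose_eq_zero_of_lt (show n < 2 * k + 1 by omega)]
  rw [h2]
  rw [h4, h6] at h3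
  linear_combination (2 * k + 1) * (catalan k : ℤ) * c ^ k * h3
    - (catalan k : ℤ) * c ^ k * b ^ (n - 2 * k) * h5

/-! ### Closed forms for the quadratic products -/

/-- The coefficients of the square of the Legendre polynomial in powers of `(x^2 - 1) / 4`. -/
def sqCoeff (n k : ℕ) : ℚ :=
  (n.choose k : ℚ) * ((n + k).choose k : ℚ) * (k.centralBinom : ℚ)

theorem sqCoeff_zero (n : ℕ) : sqCoeff n 0 = 1 := by simp [sqCoeff]

theorem sqCoeff_eq_zero {n k : ℕ} (h : n < k) : sqCoeff n k = 0 := by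
  simp [sqCoeff, Nat.choose_eq_zero_of_lt h]

theorem cast_choose_succ (n k : ℕ) :
    (n.choose (k + 1) : ℚ) * (k + 1) = n.choose k * ((n : ℚ) - k) := by
  rcases le_or_gt k n with h | h
  · have := Nat.choose_succ_right_eq n k
    have e : ((n - k : ℕ) : ℚ) = (n : ℚ) - k := by push_cast [h]; ring
    rw [← e]
    exact_mod_cast this
  · simp [Nat.choose_eq_zero_of_lt h, Nat.choose_eq_zero_of_lt (show n < k + 1 by omega)]

theorem cast_add_succ_choose (n k : ℕ) :
    ((n + k + 1).choose k : ℚ) * (n + 1) = (n + k).choose k * ((n : ℚ) + k + 1) := by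
  have := Nat.choose_mul_succ_eq (n + k) k
  rw [show n + k + 1 - k = n + 1 by omega] at this
  have h : ((n + k).choose k : ℚ) * (n + k + 1) = (n + k + 1).choose k * (n + 1) := by
    exact_mod_cast this
  linear_combination -h

theorem cast_succ_choose_succ (n k : ℕ) :
    ((n + 1).choose (k + 1) : ℚ) * (k + 1) = n.choose k * ((n : ℚ) + 1) := by
  have := Nat.add_one_mul_choose_eq n k
  have h : ((n : ℚ) + 1) * (n.choose k) = (n + 1).choose (k + 1) * (k + 1) := by
    exact_mod_cast this
  linear_combination -h

theorem cast_centralBinom_succ (k : ℕ) :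
    ((k + 1).centralBinom : ℚ) * (k + 1) = k.centralBinom * (2 * (2 * k + 1)) := by
  have h : ((k : ℚ) + 1) * (k + 1).centralBinom = 2 * (2 * k + 1) * k.centralBinom := by
    exact_mod_cast Nat.succ_mul_centralBinom_succ k
  linear_combination h

theorem sqCoeff_succ_right (n k : ℕ) :
    sqCoeff n (k + 1)
      = sqCoeff n k * (((n : ℚ) - k) * (n + k + 1) * (2 * (2 * k + 1)) / (k + 1) ^ 3) := by
  have hk : ((k : ℚ) + 1) ≠ 0 := by positivity
  have h1 := cast_choose_succ n k
  have h2 := cast_succ_choose_succ (n + k) k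
  have h3 := cast_centralBinom_succ k
  rw [← eq_div_iff hk] at h1 h2 h3
  rw [sqCoeff, sqCoeff, h1, ← add_assoc, h2, h3]
  push_cast
  field_simp

theorem sqCoeff_succ_succ (n k : ℕ) :
    sqCoeff (n + 1) (k + 1)
      = sqCoeff n k
        * (((n : ℚ) + k + 1) * (n + k + 2) * (2 * (2 * k + 1)) / (k + 1) ^ 3) := by
  have hk : ((k : ℚ) + 1) ≠ 0 := by positivity
  have hn : ((n : ℚ) + 1) ≠ 0 := by positivity
  have h1 := cast_succ_choose_succ n k
  have h2 := cast_succ_choose_succ (n + k + 1) k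
  have h3 := cast_centralBinom_succ k
  have h4 := cast_add_succ_choose n k
  rw [← eq_div_iff hk] at h1 h2 h3
  rw [← eq_div_iff hn] at h4
  rw [sqCoeff, sqCoeff, h1, show n + 1 + (k + 1) = n + k + 1 + 1 by ring, h2, h3, h4]
  push_cast
  field_simp
  ring

/-- The polynomial with coefficients `f 0, …, f n`. -/
noncomputable def polyOf (f : ℕ → ℚ) (n : ℕ) : ℚ[X] := ∑ k ∈ range (n + 1), C (f k) * X ^ k

theorem coeff_polyOf {f : ℕ → ℚ} {n : ℕ} (hf : ∀ k, n < k → f k = 0) (j : ℕ) :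
    (polyOf f n).coeff j = f j := by
  simp only [polyOf, finsetSum_coeff, coeff_C_mul_X_pow, Finset.sum_ite_eq, Finset.mem_range]
  split_ifs with h
  · rfl
  · exact (hf j (by omega)).symm

/-- `T_n^2 / d^n` as a polynomial in `c / d`. -/
noncomputable def sqPoly (n : ℕ) : ℚ[X] := polyOf (sqCoeff n) n

/-- `n T_n M_{n-1} / (b d^{n-1})` as a polynomial in `c / d`. -/
noncomputable def mixedPoly (n : ℕ) : ℚ[X] :=
  polyOf (fun k => (k + 1) * sqCoeff n (k + 1) / (2 * (n + 1))) n

/-- `(n M_{n-1})^2 / d^{n-1}` as a polynomial in `c / d`. -/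
noncomputable def motzkinSqPoly (n : ℕ) : ℚ[X] :=
  polyOf (fun k => n * (k + 1) * sqCoeff n (k + 1) / ((k + 2) * (n + 1))) n

theorem coeff_sqPoly (n j : ℕ) : (sqPoly n).coeff j = sqCoeff n j :=
  coeff_polyOf (fun _ hk => sqCoeff_eq_zero hk) j

theorem coeff_mixedPoly (n j : ℕ) :
    (mixedPoly n).coeff j = (j + 1) * sqCoeff n (j + 1) / (2 * (n + 1)) :=
  coeff_polyOf (f := fun k => (k + 1) * sqCoeff n (k + 1) / (2 * (n + 1)))
    (fun k hk => by simp [sqCoeff_eq_zero (show n < k + 1 by omega)]) j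

theorem coeff_motzkinSqPoly (n j : ℕ) :
    (motzkinSqPoly n).coeff j = n * (j + 1) * sqCoeff n (j + 1) / ((j + 2) * (n + 1)) :=
  coeff_polyOf (f := fun k => n * (k + 1) * sqCoeff n (k + 1) / ((k + 2) * (n + 1)))
    (fun k hk => by simp [sqCoeff_eq_zero (show n < k + 1 by omega)]) j

/-- This and the next two identities are the square of the linear system, with `b²` replaced by `d +
4c` and `X` standing for `c/d`. The ratio formulas for `sqCoeff` reduce each coefficient to a
rational function identity. -/
theorem sqPoly_succ (n : ℕ) :
    sqPoly (n + 1) = sqPoly n + X * (C 4 * sqPoly n + C 4 * mixedPoly n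
      + X * (C 16 * mixedPoly n + C 4 * motzkinSqPoly n)) := by
  have hn : ((n : ℚ) + 1) ≠ 0 := by positivity
  ext j
  rcases j with _ | _ | j
  · simp [coeff_sqPoly, sqCoeff_zero]
  · simp only [coeff_add, coeff_X_mul, coeff_C_mul, coeff_X_mul_zero, coeff_sqPoly,
      coeff_mixedPoly, sqCoeff_succ_succ, sqCoeff_succ_right, sqCoeff_zero]
    push_cast
    field_simp
    ring
  · have h1 : ((j : ℚ) + 1) ≠ 0 := by positivity
    have h2 : ((j : ℚ) + 2) ≠ 0 := by positivity
    have h3 : ((j : ℚ) + 1 + 1) ≠ 0 := by positivity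
    simp only [coeff_add, coeff_X_mul, coeff_C_mul, coeff_sqPoly, coeff_mixedPoly,
      coeff_motzkinSqPoly, sqCoeff_succ_succ n (j + 1), sqCoeff_succ_right n (j + 1)]
    push_cast
    field_simp
    ring

theorem mixedPoly_succ (n : ℕ) :
    C ((n : ℚ) + 2) * mixedPoly (n + 1) = C ((n : ℚ) + 1) * (C 2 * sqPoly n + mixedPoly n
      + X * (C 8 * mixedPoly n + C 2 * motzkinSqPoly n)) := by
  have hn : ((n : ℚ) + 1) ≠ 0 := by positivity
  have hn : ((n : ℚ) + 1 + 1) ≠ 0 := by positivity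
  ext j
  rcases j with _ | j
  · simp only [coeff_add, coeff_C_mul, coeff_X_mul_zero, coeff_sqPoly,
      coeff_mixedPoly, sqCoeff_succ_succ, sqCoeff_succ_right, sqCoeff_zero]
    push_cast
    field_simp
    ring
  · have h2 : ((j : ℚ) + 2) ≠ 0 := by positivity
    have h3 : ((j : ℚ) + 1 + 1) ≠ 0 := by positivity
    simp only [coeff_add, coeff_X_mul, coeff_C_mul, coeff_sqPoly, coeff_mixedPoly,
      coeff_motzkinSqPoly, sqCoeff_succ_succ n (j + 1), sqCoeff_succ_right n (j + 1)]
    push_cast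
    field_simp
    ring

theorem motzkinSqPoly_succ (n : ℕ) :
    C (((n : ℚ) + 2) ^ 2) * motzkinSqPoly (n + 1) = C (((n : ℚ) + 1) ^ 2) *
      (C 4 * sqPoly n + C 4 * mixedPoly n + motzkinSqPoly n
        + X * (C 16 * mixedPoly n + C 4 * motzkinSqPoly n)) := by
  have hn : ((n : ℚ) + 1) ≠ 0 := by positivity
  have hn : ((n : ℚ) + 1 + 1) ≠ 0 := by positivity
  ext j
  rcases j with _ | j
  · simp only [coeff_add, coeff_C_mul, coeff_X_mul_zero, coeff_sqPoly,
      coeff_mixedPoly, coeff_motzkinSqPoly, sqCoeff_succ_succ, sqCoeff_succ_right, sqCoeff_zero]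
    push_cast
    field_simp
    ring
  · have h2 : ((j : ℚ) + 2) ≠ 0 := by positivity
    have h3 : ((j : ℚ) + 1 + 1) ≠ 0 := by positivity
    have h3 : ((j : ℚ) + 1 + 2) ≠ 0 := by positivity
    simp only [coeff_add, coeff_X_mul, coeff_C_mul, coeff_sqPoly, coeff_mixedPoly,
      coeff_motzkinSqPoly, sqCoeff_succ_succ n (j + 1), sqCoeff_succ_right n (j + 1)]
    push_cast
    field_simp
    ring

/-- The three products must be carried together: the recurrence for each one involves the other two.
-/
theorem products_eq_eval {b c d : ℤ} (hd : d = b ^ 2 - 4 * c) (hd0 : d ≠ 0) (n : ℕ) :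
    ((T n b c : ℚ) ^ 2 = (d : ℚ) ^ n * (sqPoly n).eval ((c : ℚ) / d)) ∧
    ((T n b c : ℚ) * shiftM n b c = b / d * (d : ℚ) ^ n * (mixedPoly n).eval ((c : ℚ) / d)) ∧
    ((shiftM n b c : ℚ) ^ 2 = (d : ℚ) ^ n / d * (motzkinSqPoly n).eval ((c : ℚ) / d)) := by
  have hdq : (d : ℚ) ≠ 0 := by exact_mod_cast hd0
  have hb : (b : ℚ) ^ 2 = d + 4 * c := by rw [hd]; push_cast; ring
  induction n with
  | zero =>
    refine ⟨?_, ?_, ?_⟩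
    · simp [T_eq_sum, sqPoly, polyOf, sqCoeff_zero]
    · simp [shiftM, mixedPoly, polyOf, sqCoeff]
    · simp [shiftM, motzkinSqPoly, polyOf]
  | succ n ih =>
    obtain ⟨h1, h2, h3⟩ := ih
    have hn : ((n : ℚ) + 2) ≠ 0 := by positivity
    have hT : (T (n + 1) b c : ℚ) = b * T n b c + 2 * c * shiftM n b c := by
      exact_mod_cast T_succ n b c
    have hM : ((n : ℚ) + 2) * shiftM (n + 1) b c
        = (n + 1) * (2 * T n b c + b * shiftM n b c) := by
      have : ((n : ℚ) + 2) * M n b c = 2 * T n b c + b * shiftM n b c := by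
        exact_mod_cast add_two_mul_M n b c
      rw [shiftM, Nat.add_sub_cancel]
      push_cast
      linear_combination ((n : ℚ) + 1) * this
    have e1 := congrArg (eval ((c : ℚ) / d)) (sqPoly_succ n)
    have e2 := congrArg (eval ((c : ℚ) / d)) (mixedPoly_succ n)
    have e3 := congrArg (eval ((c : ℚ) / d)) (motzkinSqPoly_succ n)
    simp only [eval_add, eval_mul, eval_X, eval_C] at e1 e2 e3
    generalize eval ((c : ℚ) / d) (sqPoly n) = A at *
    generalize eval ((c : ℚ) / d) (mixedPoly n) = B at *
    generalize eval ((c : ℚ) / d) (motzkinSqPoly n) = G at *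
    set t : ℚ := (T n b c : ℚ)
    set m : ℚ := (shiftM n b c : ℚ)
    have f1 : (T (n + 1) b c : ℚ) ^ 2
        = (d + 4 * c) * (d ^ n * A) + 4 * c * (d + 4 * c) / d * d ^ n * B
          + 4 * c ^ 2 * (d ^ n / d * G) := by
      rw [hT]
      linear_combination (b : ℚ) ^ 2 * h1 + 4 * c * b * h2 + 4 * c ^ 2 * h3
        + ((d : ℚ) ^ n * A + 4 * c / d * d ^ n * B) * hb
    have f2 : ((n : ℚ) + 2) * (T (n + 1) b c * shiftM (n + 1) b c)
        = (n + 1) * b * (2 * (d ^ n * A) + (d + 8 * c) / d * d ^ n * B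
          + 2 * c * (d ^ n / d * G)) := by
      rw [show ((n : ℚ) + 2) * (T (n + 1) b c * shiftM (n + 1) b c)
        = T (n + 1) b c * (((n : ℚ) + 2) * shiftM (n + 1) b c) by ring, hM, hT]
      linear_combination ((n : ℚ) + 1) * (2 * b * h1 + (b ^ 2 + 4 * c) * h2 + 2 * c * b * h3)
        + ((n : ℚ) + 1) * b / d * d ^ n * B * hb
    have f3 : ((n : ℚ) + 2) ^ 2 * (shiftM (n + 1) b c : ℚ) ^ 2
        = (n + 1) ^ 2 * (4 * (d ^ n * A) + 4 * (d + 4 * c) / d * d ^ n * B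
          + (d + 4 * c) * (d ^ n / d * G)) := by
      rw [← mul_pow, hM]
      linear_combination ((n : ℚ) + 1) ^ 2 * (4 * h1 + 4 * b * h2 + b ^ 2 * h3)
        + ((n : ℚ) + 1) ^ 2 * (4 / d * d ^ n * B + d ^ n / d * G) * hb
    refine ⟨?_, ?_, ?_⟩
    · rw [f1, e1]
      field_simp
      ring
    · refine mul_left_cancel₀ hn ?_
      rw [f2, mul_left_comm ((n : ℚ) + 2), e2]
      field_simp
      ring
    · refine mul_left_cancel₀ (pow_ne_zero 2 hn) ?_
      rw [f3, mul_left_comm (((n : ℚ) + 2) ^ 2), e3]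
      field_simp
      ring

/-! ### Partial sums of `T_k M_k / d^k` -/

/-- `n w(n,k+1) C_k`. -/
def sumCoeff (n k : ℕ) : ℕ := n.choose (k + 1) * (n + k + 1).choose k * catalan k

theorem sumCoeff_eq_zero {n k : ℕ} (h : n ≤ k) : sumCoeff n k = 0 := by
  simp [sumCoeff, Nat.choose_eq_zero_of_lt (show n < k + 1 by omega)]

theorem cast_sumCoeff (n k : ℕ) :
    (sumCoeff n k : ℚ) = (k + 1) * sqCoeff n (k + 1) / (2 * (2 * k + 1) * (n + 1)) := by
  have hk : ((k : ℚ) + 1) ≠ 0 := by positivity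
  have hk2 : (2 * (k : ℚ) + 1) ≠ 0 := by positivity
  have hn : ((n : ℚ) + 1) ≠ 0 := by positivity
  have h1 := cast_choose_succ n k
  have h4 := cast_add_succ_choose n k
  have h5 : (k.centralBinom : ℚ) = (k + 1) * catalan k := by
    exact_mod_cast centralBinom_eq_mul_catalan k
  rw [← eq_div_iff hk] at h1
  rw [← eq_div_iff hn] at h4
  rw [sumCoeff, sqCoeff_succ_right, sqCoeff, h5]
  push_cast
  rw [h1, h4]
  field_simp

/-- `∑_{k<n} T_k M_k / d^k` as a polynomial in `c / d`. -/
noncomputable def sumPoly (n : ℕ) : ℚ[X] := polyOf (fun k => (sumCoeff n k : ℚ)) n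

theorem coeff_sumPoly (n j : ℕ) : (sumPoly n).coeff j = sumCoeff n j :=
  coeff_polyOf (f := fun k => (sumCoeff n k : ℚ))
    (fun k hk => by simp [sumCoeff_eq_zero hk.le]) j

/-- The telescoping step: the right side is `(n+2) T_n M_n / d^n` expressed through `T_n²` and `n
T_n M_{n-1}`. -/
theorem sumPoly_succ_sub (n : ℕ) :
    C ((n : ℚ) + 2) * (sumPoly (n + 1) - sumPoly n)
      = C 2 * sqPoly n + mixedPoly n + X * (C 4 * mixedPoly n) := by
  have hn : ((n : ℚ) + 1) ≠ 0 := by positivity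
  have hn : ((n : ℚ) + 1 + 1) ≠ 0 := by positivity
  ext j
  rcases j with _ | j
  · simp only [coeff_add, coeff_sub, coeff_C_mul, coeff_X_mul_zero, coeff_sqPoly, coeff_sumPoly,
      coeff_mixedPoly, cast_sumCoeff, sqCoeff_succ_succ, sqCoeff_succ_right, sqCoeff_zero]
    push_cast
    field_simp
    ring
  · have h1 : (2 * ((j : ℚ) + 1) + 1) ≠ 0 := by positivity
    have h2 : ((j : ℚ) + 2) ≠ 0 := by positivity
    have h3 : ((j : ℚ) + 1 + 1) ≠ 0 := by positivity
    simp only [coeff_add, coeff_sub, coeff_X_mul, coeff_C_mul, coeff_sqPoly, coeff_mixedPoly,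
      coeff_sumPoly, cast_sumCoeff, sqCoeff_succ_succ n (j + 1), sqCoeff_succ_right n (j + 1)]
    push_cast
    field_simp
    ring

theorem sum_T_mul_M_div_pow {b c d : ℤ} (hd : d = b ^ 2 - 4 * c) (hd0 : d ≠ 0) (n : ℕ) :
    ∑ k ∈ range n, (T k b c : ℚ) * (M k b c : ℚ) / (d : ℚ) ^ k
      = ∑ k ∈ range n, (sumCoeff n k : ℚ) * ((c : ℚ) / d) ^ k := by
  have hdq : (d : ℚ) ≠ 0 := by exact_mod_cast hd0
  have hb : (b : ℚ) ^ 2 = d + 4 * c := by rw [hd]; push_cast; ring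
  have key : ∀ n, ∑ k ∈ range n, (T k b c : ℚ) * (M k b c : ℚ) / (d : ℚ) ^ k
      = (sumPoly n).eval ((c : ℚ) / d) := by
    intro n
    induction n with
    | zero => simp [sumPoly, polyOf, sumCoeff_eq_zero]
    | succ n ih =>
      have hn : ((n : ℚ) + 2) ≠ 0 := by positivity
      obtain ⟨h1, h2, -⟩ := products_eq_eval hd hd0 n
      have hM : ((n : ℚ) + 2) * M n b c = 2 * T n b c + b * shiftM n b c := by
        exact_mod_cast add_two_mul_M n b c
      have e := congrArg (eval ((c : ℚ) / d)) (sumPoly_succ_sub n)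
      simp only [eval_add, eval_sub, eval_mul, eval_X, eval_C] at e
      have e2 : ((n : ℚ) + 2) * (T n b c * M n b c)
          = d ^ n * (2 * (sqPoly n).eval ((c : ℚ) / d)
            + (d + 4 * c) / d * (mixedPoly n).eval ((c : ℚ) / d)) := by
        rw [mul_left_comm, hM]
        linear_combination 2 * h1 + b * h2
          + (d : ℚ) ^ n / d * (mixedPoly n).eval ((c : ℚ) / d) * hb
      have e3 : ((n : ℚ) + 2) * (T n b c * M n b c / d ^ n)
          = ((n : ℚ) + 2) * ((sumPoly (n + 1)).eval ((c : ℚ) / d)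
            - (sumPoly n).eval ((c : ℚ) / d)) := by
        rw [← mul_div_assoc, e2, e]
        field_simp
        ring
      have e4 := mul_left_cancel₀ hn e3
      rw [Finset.sum_range_succ, ih, e4]
      ring
  rw [key, sumPoly, polyOf, Finset.sum_range_succ, sumCoeff_eq_zero le_rfl]
  simp [eval_finsetSum]

/-! ### Integrality of `w` and the exact identities -/

/-- The integer value of `w(n,k+1)`. -/
def wInt (n k : ℕ) : ℤ :=
  ((n - 1).choose k : ℤ) * ((n + k + 1).choose (k + 1) : ℤ)
    - (n.choose (k + 1) : ℤ) * ((n + k + 1).choose k : ℤ)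

theorem succ_mul_w (n k : ℕ) :
    ((n : ℚ) + 1) * w n (k + 1) = ((n - 1).choose k : ℚ) * ((n + k + 1).choose (k + 1) : ℚ) := by
  have hk : ((k : ℚ) + 1) ≠ 0 := by positivity
  have h := cast_choose_succ (n + k + 1) k
  rw [← eq_div_iff hk] at h
  rw [w, h, Nat.add_sub_cancel, ← add_assoc]
  push_cast
  field_simp
  ring

theorem mul_w (n k : ℕ) (hn : 1 ≤ n) :
    (n : ℚ) * w n (k + 1) = (n.choose (k + 1) : ℚ) * ((n + k + 1).choose k : ℚ) := by
  obtain ⟨n, rfl⟩ := Nat.exists_eq_add_of_le' hn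
  have hk : ((k : ℚ) + 1) ≠ 0 := by positivity
  have h := cast_succ_choose_succ n k
  rw [← eq_div_iff hk] at h
  rw [w, h, Nat.add_sub_cancel, Nat.add_sub_cancel, ← add_assoc]
  push_cast
  field_simp

/-- `w = (n+1) w - n w`, and both terms are products of binomial coefficients. -/
theorem w_eq_wInt (n k : ℕ) (hn : 1 ≤ n) : w n (k + 1) = wInt n k := by
  rw [wInt]
  push_cast
  linear_combination succ_mul_w n k - mul_w n k hn

theorem mul_wInt (n k : ℕ) (hn : 1 ≤ n) :
    (n : ℤ) * wInt n k = (n.choose (k + 1) : ℤ) * ((n + k + 1).choose k : ℤ) := by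
  have := mul_w n k hn
  rw [w_eq_wInt n k hn] at this
  exact_mod_cast this

theorem succ_mul_wInt (n k : ℕ) (hn : 1 ≤ n) :
    ((n : ℤ) + 1) * wInt n k = ((n - 1).choose k : ℤ) * ((n + k + 1).choose (k + 1) : ℤ) := by
  have := succ_mul_w n k
  rw [w_eq_wInt n k hn] at this
  exact_mod_cast this

theorem sumCoeff_eq_mul_wInt (n k : ℕ) (hn : 1 ≤ n) :
    (sumCoeff n k : ℤ) = n * (wInt n k * catalan k) := by
  rw [sumCoeff, ← mul_assoc, mul_wInt n k hn]
  push_cast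
  ring

theorem sum_Icc_one_eq_sum_range {R : Type*} [AddCommMonoid R] (f : ℕ → R) (n : ℕ) :
    ∑ k ∈ Icc 1 n, f k = ∑ k ∈ range n, f (k + 1) := by
  rw [Finset.range_eq_Ico, Finset.sum_Ico_add' f 0 n 1]
  rfl

theorem sum_neg_one_eq (n : ℕ) (hn : 1 ≤ n) :
    ∑ k ∈ Icc 1 n, (-1 : ℚ) ^ (k - 1) * w n k * (catalan (k - 1) : ℚ) * 5 ^ (n - k)
      = ((∑ k ∈ range n, (-1) ^ k * wInt n k * catalan k * 5 ^ (n - 1 - k) : ℤ) : ℚ) := by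
  rw [sum_Icc_one_eq_sum_range]
  push_cast
  refine Finset.sum_congr rfl fun k _ => ?_
  rw [w_eq_wInt n k hn, show n - (k + 1) = n - 1 - k by omega]

theorem sum_one_eq (n : ℕ) (hn : 1 ≤ n) :
    ∑ k ∈ Icc 1 n, w n k * (catalan (k - 1) : ℚ)
      = ((∑ k ∈ range n, wInt n k * catalan k : ℤ) : ℚ) := by
  rw [sum_Icc_one_eq_sum_range]
  push_cast
  refine Finset.sum_congr rfl fun k _ => ?_
  rw [w_eq_wInt n k hn]

theorem sum_T_mul_M_neg_one (n : ℕ) (hn : 1 ≤ n) :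
    ∑ k ∈ range n, (T k 1 (-1) : ℚ) * (M k 1 (-1) : ℚ) * 5 ^ (n - 1 - k)
      = n * ((∑ k ∈ range n, (-1) ^ k * wInt n k * catalan k * 5 ^ (n - 1 - k) : ℤ) : ℚ) := by
  have h := sum_T_mul_M_div_pow (b := 1) (c := -1) (d := 5) (by norm_num) (by norm_num) n
  have e : ∀ k ∈ range n, (5 : ℚ) ^ (n - 1 - k) = 5 ^ (n - 1) / 5 ^ k := by
    intro k hk
    have : k ≤ n - 1 := by have := Finset.mem_range.1 hk; omega
    rw [pow_sub₀ _ (by norm_num) this, div_eq_mul_inv]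
  have h1 : ∑ k ∈ range n, (T k 1 (-1) : ℚ) * (M k 1 (-1) : ℚ) * 5 ^ (n - 1 - k)
      = 5 ^ (n - 1) * ∑ k ∈ range n, (T k 1 (-1) : ℚ) * (M k 1 (-1) : ℚ) / ((5 : ℤ) : ℚ) ^ k := by
    rw [Finset.mul_sum]
    refine Finset.sum_congr rfl fun k hk => ?_
    rw [e k hk]
    push_cast
    ring
  rw [h1, h]
  push_cast
  rw [Finset.mul_sum, Finset.mul_sum]
  refine Finset.sum_congr rfl fun k hk => ?_
  have hs : (sumCoeff n k : ℚ) = n * (wInt n k * catalan k) := by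
    exact_mod_cast sumCoeff_eq_mul_wInt n k hn
  rw [e k hk, hs, div_pow]
  ring

theorem sum_T_mul_M_five (n : ℕ) (hn : 1 ≤ n) :
    ∑ k ∈ range n, (T k 5 5 : ℚ) * (M k 5 5 : ℚ) / 5 ^ k
      = n * ((∑ k ∈ range n, wInt n k * catalan k : ℤ) : ℚ) := by
  have h := sum_T_mul_M_div_pow (b := 5) (c := 5) (d := 5) (by norm_num) (by norm_num) n
  push_cast at h
  rw [h]
  push_cast
  rw [Finset.mul_sum]
  refine Finset.sum_congr rfl fun k hk => ?_
  have hs : (sumCoeff n k : ℚ) = n * (wInt n k * catalan k) := by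
    exact_mod_cast sumCoeff_eq_mul_wInt n k hn
  rw [hs]
  norm_num

/-! ### Binomial coefficients modulo `p` and `p²` -/

theorem cast_choose_prime_sub_one (p : ℕ) [hp : Fact p.Prime] {j : ℕ} (hj : j < p) :
    ((p - 1).choose j : ZMod p) = (-1) ^ j := by
  induction j with
  | zero => simp
  | succ j ih =>
    have h := Nat.choose_succ_succ (p - 1) j
    rw [Nat.succ_eq_add_one, Nat.succ_eq_add_one, Nat.sub_add_cancel hp.out.one_le] at h
    have h0 : (p.choose (j + 1) : ZMod p) = 0 :=
      (ZMod.natCast_eq_zero_iff _ _).2 (hp.out.dvd_choose_self (Nat.succ_ne_zero j) hj)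
    have h1 : (p.choose (j + 1) : ZMod p) = (p - 1).choose j + (p - 1).choose (j + 1) := by
      exact_mod_cast congrArg (Nat.cast : ℕ → ZMod p) h
    rw [h0, ih (by omega)] at h1
    linear_combination -h1

/-- `binom(p,k) / p`, an integer for `0 < k < p`. -/
def chooseQuot (p k : ℕ) : ℕ := p.choose k / p

theorem mul_chooseQuot (p : ℕ) [hp : Fact p.Prime] {k : ℕ} (h0 : k ≠ 0) (hk : k < p) :
    p * chooseQuot p k = p.choose k :=
  Nat.mul_div_cancel' (hp.out.dvd_choose_self h0 hk)

theorem cast_succ_mul_chooseQuot (p : ℕ) [hp : Fact p.Prime] {k : ℕ} (hk : k + 1 < p) :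
    ((k : ZMod p) + 1) * chooseQuot p (k + 1) = (-1) ^ k := by
  have h := Nat.add_one_mul_choose_eq (p - 1) k
  rw [Nat.sub_add_cancel hp.out.one_le, ← mul_chooseQuot p (Nat.succ_ne_zero k) hk,
    mul_assoc] at h
  have h' := Nat.eq_of_mul_eq_mul_left hp.out.pos h
  rw [← cast_choose_prime_sub_one p (show k < p by omega), h']
  push_cast
  ring

theorem cast_ne_zero_of_lt (p : ℕ) [Fact p.Prime] {k : ℕ} (h0 : k ≠ 0) (hk : k < p) :
    (k : ZMod p) ≠ 0 := by
  rw [Ne, ZMod.natCast_eq_zero_iff]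
  exact fun h => absurd (Nat.le_of_dvd (Nat.pos_of_ne_zero h0) h) (by omega)

theorem cast_prime_sq (p : ℕ) : (p : ZMod (p ^ 2)) * p = 0 := by
  have := ZMod.natCast_self (p ^ 2)
  rw [← sq]
  exact_mod_cast this

/-- Terms carrying a factor `p` need only be known modulo `p`; this lifts such information to
modulus `p²`. -/
theorem cast_prime_mul_eq {p : ℕ} {a b : ℤ} (h : (a : ZMod p) = b) :
    (p : ZMod (p ^ 2)) * a = p * b := by
  rw [ZMod.intCast_eq_intCast_iff_dvd_sub] at h
  have : (((p * a : ℤ)) : ZMod (p ^ 2)) = ((p * b : ℤ) : ZMod (p ^ 2)) := by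
    rw [ZMod.intCast_eq_intCast_iff_dvd_sub]
    push_cast
    rw [← mul_sub, sq]
    exact mul_dvd_mul_left _ h
  exact_mod_cast this

theorem isUnit_cast_of_not_dvd {p k : ℕ} (hp : p.Prime) (h : ¬ p ∣ k) :
    IsUnit (k : ZMod (p ^ 2)) := by
  rw [ZMod.isUnit_iff_coprime]
  exact ((hp.coprime_iff_not_dvd.2 h).symm).pow_right 2

theorem isUnit_cast_of_lt {p k : ℕ} (hp : p.Prime) (h0 : k ≠ 0) (h : k < p) :
    IsUnit (k : ZMod (p ^ 2)) :=
  isUnit_cast_of_not_dvd hp fun hd => absurd (Nat.le_of_dvd (Nat.pos_of_ne_zero h0) hd) (by omega)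

theorem cast_prime_mul_choose (p : ℕ) [Fact p.Prime] {k : ℕ} (h0 : k ≠ 0) (hk : k < p) :
    (p : ZMod (p ^ 2)) * p.choose k = 0 := by
  rw [← mul_chooseQuot p h0 hk]
  push_cast
  rw [← mul_assoc, cast_prime_sq, zero_mul]

theorem cast_choose_mul_choose (p : ℕ) [Fact p.Prime] {k l : ℕ} (h0 : k ≠ 0) (hk : k < p)
    (h1 : l ≠ 0) (hl : l < p) : (p.choose k : ZMod (p ^ 2)) * p.choose l = 0 := by
  rw [← mul_chooseQuot p h0 hk, ← mul_chooseQuot p h1 hl]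
  push_cast
  linear_combination (chooseQuot p k : ZMod (p ^ 2)) * chooseQuot p l * cast_prime_sq p

theorem cast_two_mul_prime_choose (p : ℕ) [Fact p.Prime] {k : ℕ} (h0 : k ≠ 0) (hk : k ≤ p) :
    ((2 * p).choose k : ZMod (p ^ 2)) = 2 * p.choose k := by
  obtain ⟨k, rfl⟩ := Nat.exists_eq_succ_of_ne_zero h0
  -- Vandermonde: every mixed term is a product of two multiples of `p`, so only the two end terms
  -- survive.
  rw [two_mul, Nat.add_choose_eq, Finset.Nat.sum_antidiagonal_eq_sum_range_succ_mk,
    Finset.sum_range_succ, Finset.sum_range_succ']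
  push_cast
  rw [Finset.sum_eq_zero]
  · simp [two_mul]
  · intro i hi
    have hi := Finset.mem_range.1 hi
    exact cast_choose_mul_choose p (by omega) (by omega) (by omega) (by omega)

theorem cast_choose_mul_add_choose (p : ℕ) [hp : Fact p.Prime] {k : ℕ} (hk : k + 1 < p) :
    ((p - 1).choose k : ZMod (p ^ 2)) * ((p + k + 1).choose (k + 1))
      = (-1) ^ k + p.choose (k + 1) := by
  induction k with
  | zero => simp [add_comm]
  | succ k ih =>
    have ih := ih (by omega)
    have h1 : ((p - 1).choose (k + 1) : ℤ) * (k + 1) = (p - 1).choose k * ((p : ℤ) - 1 - k) := by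
      have := Nat.choose_succ_right_eq (p - 1) k
      have e : ((p - 1 - k : ℕ) : ℤ) = (p : ℤ) - 1 - k := by omega
      rw [← e]
      exact_mod_cast this
    have h2 : ((p + k + 2).choose (k + 2) : ℤ) * (k + 2)
        = ((p : ℤ) + k + 2) * (p + k + 1).choose (k + 1) := by
      have := Nat.add_one_mul_choose_eq (p + k + 1) (k + 1)
      zify at this
      linear_combination -this
    have h3 : ((p.choose (k + 1) : ℤ) + p.choose (k + 2)) * ((k + 1) * (k + 2))
        = (p + 1) * p * (p - 1).choose k := by
      have e1 := Nat.choose_succ_succ p (k + 1)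
      have e2 := Nat.add_one_mul_choose_eq p (k + 1)
      have e3 := Nat.add_one_mul_choose_eq (p - 1) k
      rw [Nat.sub_add_cancel hp.out.one_le] at e3
      zify at e1 e2 e3
      linear_combination -((k : ℤ) + 1) * (k + 2) * e1 - ((k : ℤ) + 1) * e2 - ((p : ℤ) + 1) * e3
    have h4 : (p : ZMod (p ^ 2)) * ((p - 1).choose k) = p * (-1) ^ k := by
      have : (((p - 1).choose k : ℤ) : ZMod p) = (((-1) ^ k : ℤ) : ZMod p) := by
        push_cast
        exact cast_choose_prime_sub_one p (by omega)
      exact_mod_cast cast_prime_mul_eq this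
    have h5 := cast_prime_mul_choose p (Nat.succ_ne_zero k) (show k + 1 < p by omega)
    have h0 := cast_prime_sq p
    apply_fun (Int.cast : ℤ → ZMod (p ^ 2)) at h1 h2 h3
    push_cast at h1 h2 h3
    have u1 : IsUnit ((k : ZMod (p ^ 2)) + 1) := by
      exact_mod_cast isUnit_cast_of_lt hp.out (Nat.succ_ne_zero k) (show k + 1 < p by omega)
    have u2 : IsUnit ((k : ZMod (p ^ 2)) + 2) := by
      exact_mod_cast isUnit_cast_of_lt hp.out (Nat.succ_ne_zero (k + 1)) (show k + 1 + 1 < p by omega)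
    -- After multiplying by `(k+1)(k+2)`, the ratio of consecutive products is governed by
    -- `(p-1-k)(p+k+2) = p² + p - (k+1)(k+2)`.
    refine (u1.mul u2).mul_left_cancel ?_
    rw [show p + (k + 1) + 1 = p + k + 2 by ring, show k + 1 + 1 = k + 2 by ring]
    linear_combination ((p + k + 2).choose (k + 2) : ZMod (p ^ 2)) * (k + 2) * h1
      + ((p - 1).choose k : ZMod (p ^ 2)) * ((p : ZMod (p ^ 2)) - 1 - k) * h2
      + (((p : ZMod (p ^ 2)) * p + p - (k + 1) * (k + 2))) * ih
      - h3 - (p + 1) * h4 + h5 + ((-1) ^ k + p.choose (k + 1)) * h0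
      - (-1) ^ k * h0

/-- Divide the product formula for `(p+1) w` by `p+1`, whose inverse modulo `p²` is `1-p`; that
factor does not affect `binom(p,k+1)`, already a multiple of `p`. -/
theorem cast_wInt_prime (p : ℕ) [hp : Fact p.Prime] {k : ℕ} (hk : k + 1 < p) :
    (wInt p k : ZMod (p ^ 2)) = (1 - p) * (-1) ^ k + p.choose (k + 1) := by
  have h := succ_mul_wInt p k hp.out.one_le
  apply_fun (Int.cast : ℤ → ZMod (p ^ 2)) at h
  push_cast at h
  rw [cast_choose_mul_add_choose p hk] at h
  linear_combination (1 - (p : ZMod (p ^ 2))) * h + (wInt p k : ZMod (p ^ 2)) * cast_prime_sq p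
    - cast_prime_mul_choose p (Nat.succ_ne_zero k) hk

theorem cast_centralBinom_prime (p : ℕ) [hp : Fact p.Prime] :
    (p.centralBinom : ZMod (p ^ 2)) = 2 := by
  rw [Nat.centralBinom_eq_two_mul_choose, cast_two_mul_prime_choose p hp.out.ne_zero le_rfl]
  simp

theorem cast_wInt_prime_last (p : ℕ) [hp : Fact p.Prime] :
    (wInt p (p - 1) : ZMod (p ^ 2)) = 2 * (1 - p) := by
  have h := succ_mul_wInt p (p - 1) hp.out.one_le
  apply_fun (Int.cast : ℤ → ZMod (p ^ 2)) at h
  rw [show p + (p - 1) + 1 = 2 * p by have := hp.out.one_le; omega,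
    Nat.sub_add_cancel hp.out.one_le, ← Nat.centralBinom_eq_two_mul_choose, Nat.choose_self] at h
  push_cast at h
  rw [cast_centralBinom_prime] at h
  linear_combination (1 - (p : ZMod (p ^ 2))) * h
    + (wInt p (p - 1) : ZMod (p ^ 2)) * cast_prime_sq p

theorem isUnit_two (p : ℕ) [hp : Fact p.Prime] (h2 : p ≠ 2) : IsUnit (2 : ZMod (p ^ 2)) := by
  have : 2 < p := lt_of_le_of_ne hp.out.two_le (Ne.symm h2)
  exact_mod_cast isUnit_cast_of_lt hp.out two_ne_zero this

theorem cast_catalan_prime_sub_one (p : ℕ) [hp : Fact p.Prime] (h2 : p ≠ 2) :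
    (catalan (p - 1) : ZMod (p ^ 2)) = -(1 + 2 * p) := by
  have h := centralBinom_succ_eq_mul_catalan (p - 1)
  rw [Nat.sub_add_cancel hp.out.one_le] at h
  zify [hp.out.one_le] at h
  apply_fun (Int.cast : ℤ → ZMod (p ^ 2)) at h
  push_cast at h
  rw [cast_centralBinom_prime] at h
  refine (isUnit_two p h2).mul_left_cancel ?_
  linear_combination (1 + 2 * (p : ZMod (p ^ 2))) * h
    + 8 * (catalan (p - 1) : ZMod (p ^ 2)) * cast_prime_sq p

/-! ### Binomial transforms, Fibonacci and Lucas numbers -/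

/-- The binomial transform of a sequence. -/
def binSum (f : ℕ → ℤ) (n : ℕ) : ℤ := ∑ j ∈ range (n + 1), (n.choose j : ℤ) * f j

theorem binSum_succ (f : ℕ → ℤ) (n : ℕ) :
    binSum f (n + 1) = binSum f n + binSum (fun j => f (j + 1)) n := by
  have h : binSum f n = ∑ j ∈ range (n + 2), (n.choose j : ℤ) * f j := by
    rw [Finset.sum_range_succ _ (n + 1), Nat.choose_succ_self]
    simp [binSum]
  rw [h, binSum, binSum, Finset.sum_range_succ', Finset.sum_range_succ' _ (n + 1),
    add_right_comm, ← Finset.sum_add_distrib]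
  congr 1
  · refine Finset.sum_congr rfl fun j _ => ?_
    rw [Nat.choose_succ_succ]
    push_cast
    ring
  · simp

/-- The Lucas numbers. -/
def luc (n : ℕ) : ℤ := 2 * Nat.fib (n + 1) - Nat.fib n

theorem cast_fib_add_two (n : ℕ) : (Nat.fib (n + 2) : ℤ) = Nat.fib n + Nat.fib (n + 1) := by
  exact_mod_cast Nat.fib_add_two

theorem luc_add_two (n : ℕ) : luc (n + 2) = luc n + luc (n + 1) := by
  simp only [luc, add_assoc, Nat.reduceAdd]
  rw [cast_fib_add_two (n + 1), cast_fib_add_two n]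
  ring

theorem two_mul_luc_succ (n : ℕ) : 2 * luc (n + 1) = luc n + 5 * Nat.fib n := by
  simp only [luc, add_assoc, Nat.reduceAdd]
  rw [cast_fib_add_two n]
  ring

theorem two_mul_fib_succ (n : ℕ) : 2 * (Nat.fib (n + 1) : ℤ) = Nat.fib n + luc n := by
  rw [luc]; ring

theorem luc_sq (n : ℕ) : luc n ^ 2 = 5 * (Nat.fib n : ℤ) ^ 2 + 4 * (-1) ^ n := by
  induction n with
  | zero => simp [luc]
  | succ n ih =>
    have h1 := two_mul_luc_succ n
    have h2 := two_mul_fib_succ n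
    have : 4 * luc (n + 1) ^ 2 = 4 * (5 * (Nat.fib (n + 1) : ℤ) ^ 2 + 4 * (-1) ^ (n + 1)) := by
      rw [show 4 * luc (n + 1) ^ 2 = (2 * luc (n + 1)) ^ 2 by ring, h1, pow_succ (-1 : ℤ) n]
      linear_combination -5 * (2 * (Nat.fib (n + 1) : ℤ) + Nat.fib n + luc n) * h2 - 4 * ih
    exact mul_left_cancel₀ (by norm_num) this

/-- Such `f` combine the powers of `±√5`, and `(1 ± √5)^n` is `2^n` times the `n`-th power of the
golden ratio or its conjugate. Generalizing over `f` lets the induction apply to the shifted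
sequence. -/
theorem two_mul_binSum_of_five {f : ℕ → ℤ} (hf : ∀ j, f (j + 2) = 5 * f j) (n : ℕ) :
    2 * binSum f n = 2 ^ n * (f 0 * luc n + f 1 * Nat.fib n) := by
  induction n generalizing f with
  | zero => simp [binSum, luc, mul_comm]
  | succ n ih =>
    rw [binSum_succ, mul_add, ih hf, ih (f := fun j => f (j + 1)) (fun j => hf (j + 1)), pow_succ]
    have h1 := two_mul_luc_succ n
    have h2 := two_mul_fib_succ n
    simp only [zero_add, Nat.reduceAdd, hf 0]
    linear_combination -(2 : ℤ) ^ n * (f 0 * h1 + f 1 * h2)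

theorem binSum_succ_of_one {f : ℕ → ℤ} (hf : ∀ j, f (j + 2) = f j) (n : ℕ) :
    binSum f (n + 1) = 2 ^ n * (f 0 + f 1) := by
  induction n generalizing f with
  | zero => simp [binSum, Finset.sum_range_succ]
  | succ n ih =>
    rw [binSum_succ, ih hf, ih (f := fun j => f (j + 1)) (fun j => hf (j + 1)), pow_succ]
    simp only [zero_add, Nat.reduceAdd, hf 0]
    ring

theorem sum_choose_even_five (m : ℕ) :
    ∑ k ∈ range (m + 1), ((2 * m + 1).choose (2 * k) : ℤ) * 5 ^ k
      = 2 ^ (2 * m) * luc (2 * m + 1) := by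
  let f : ℕ → ℤ := fun j => if j % 2 = 0 then 5 ^ (j / 2) else 0
  have h := two_mul_binSum_of_five (f := f) (fun j => by
    simp only [f, Nat.add_mod_right, Nat.add_div_right j two_pos]
    split_ifs <;> simp [pow_succ, mul_comm]) (2 * m + 1)
  rw [binSum, show 2 * m + 1 + 1 = 2 * (m + 1) by ring, sum_range_two_mul] at h
  have e : ∀ k, (2 * k + 1) % 2 = 1 := fun k => by omega
  simp only [f, e, Nat.mul_mod_right, one_ne_zero, if_false, if_true, mul_zero, add_zero,
    Nat.mul_div_cancel_left _ two_pos, Nat.zero_mod, Nat.zero_div, pow_zero,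
    Nat.one_mod, zero_mul, one_mul] at h
  rw [pow_succ] at h
  linarith

theorem sum_choose_odd_five (m : ℕ) :
    ∑ k ∈ range (m + 1), ((2 * m + 1).choose (2 * k + 1) : ℤ) * 5 ^ k
      = 2 ^ (2 * m) * Nat.fib (2 * m + 1) := by
  let f : ℕ → ℤ := fun j => if j % 2 = 1 then 5 ^ (j / 2) else 0
  have h := two_mul_binSum_of_five (f := f) (fun j => by
    simp only [f, Nat.add_mod_right, Nat.add_div_right j two_pos]
    split_ifs <;> simp [pow_succ, mul_comm]) (2 * m + 1)
  rw [binSum, show 2 * m + 1 + 1 = 2 * (m + 1) by ring, sum_range_two_mul] at h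
  have e : ∀ k, (2 * k + 1) % 2 = 1 := fun k => by omega
  have e' : ∀ k, (2 * k + 1) / 2 = k := fun k => by omega
  simp only [f, e, e', Nat.mul_mod_right, zero_ne_one, if_false, if_true, mul_zero, zero_add,
    Nat.zero_mod, Nat.one_mod, zero_mul, one_mul, Nat.reduceDiv, pow_zero] at h
  rw [pow_succ] at h
  linarith

theorem sum_choose_even (m : ℕ) :
    ∑ k ∈ range (m + 1), ((2 * m + 1).choose (2 * k) : ℤ) = 2 ^ (2 * m) := by
  let f : ℕ → ℤ := fun j => if j % 2 = 0 then 1 else 0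
  have h := binSum_succ_of_one (f := f) (fun j => by simp [f]) (2 * m)
  rw [binSum, show 2 * m + 1 + 1 = 2 * (m + 1) by ring, sum_range_two_mul] at h
  have e : ∀ k, (2 * k + 1) % 2 = 1 := fun k => by omega
  simpa [f, e] using h

/-! ### Geometric sums of Catalan numbers modulo `p²` -/

/-- Applying Pascal's rule twice weights the shifts of `g` by `1, 2, 1`, and the recurrence says
exactly that this combination is multiplication by `m`. The boundary terms left over are
`binom(2n,n) - binom(2n,n+1) = C_n`. -/
theorem sum_catalan_mul_pow {m : ℤ} {g : ℕ → ℤ} (g0 : g 0 = 1) (g1 : g 1 = 1)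
    (hg : ∀ j, g (j + 2) = (m - 2) * g (j + 1) - g j) (n : ℕ) :
    ∑ k ∈ range n, (catalan k : ℤ) * m ^ (n - 1 - k)
      = ∑ i ∈ range n, ((2 * n).choose (n + i + 1) : ℤ) * g (i + 1) := by
  induction n with
  | zero => simp
  | succ n ih =>
    have hl : ∑ k ∈ range (n + 1), (catalan k : ℤ) * m ^ (n + 1 - 1 - k)
        = m * ∑ k ∈ range n, (catalan k : ℤ) * m ^ (n - 1 - k) + catalan n := by
      rw [Finset.sum_range_succ, Finset.mul_sum]
      congr 1
      · refine Finset.sum_congr rfl fun k hk => ?_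
        have := Finset.mem_range.1 hk
        rw [show n + 1 - 1 - k = n - 1 - k + 1 by omega, pow_succ]
        ring
      · simp
    have hc : (catalan n : ℤ) = (2 * n).choose n - (2 * n).choose (n + 1) := by
      have h1 : ((2 * n).choose n : ℤ) = (n + 1) * catalan n := by
        have := centralBinom_eq_mul_catalan n
        rw [Nat.centralBinom_eq_two_mul_choose] at this
        exact_mod_cast this
      have h2 : ((2 * n).choose (n + 1) : ℤ) * (n + 1) = (2 * n).choose n * n := by
        have := Nat.choose_succ_right_eq (2 * n) n
        rw [show 2 * n - n = n by omega] at this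
        exact_mod_cast this
      refine mul_left_cancel₀ (show ((n : ℤ) + 1) ≠ 0 by positivity) ?_
      linear_combination h2 - h1
    have hz : ∀ i, n ≤ i → ((2 * n).choose (n + i + 1) : ℤ) = 0 := fun i hi => by
      rw [Nat.choose_eq_zero_of_lt (by omega)]; rfl
    have hch : ∀ i, ((2 * (n + 1)).choose (n + 1 + i + 1) : ℤ)
        = (2 * n).choose (n + i) + 2 * (2 * n).choose (n + i + 1)
          + (2 * n).choose (n + (i + 1) + 1) := fun i => by
      rw [show 2 * (n + 1) = 2 * n + 1 + 1 by ring, show n + 1 + i + 1 = n + i + 1 + 1 by ring,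
        Nat.choose_succ_succ, Nat.choose_succ_succ (2 * n) (n + i),
        Nat.choose_succ_succ (2 * n) (n + i + 1)]
      push_cast
      simp only [Nat.succ_eq_add_one, ← add_assoc]
      ring
    have s1 : ∑ i ∈ range (n + 1), ((2 * n).choose (n + i) : ℤ) * g (i + 1)
        = ∑ i ∈ range n, ((2 * n).choose (n + i + 1) : ℤ) * g (i + 2) + (2 * n).choose n := by
      rw [Finset.sum_range_succ']
      simp [g1, ← add_assoc]
    have s2 : ∑ i ∈ range (n + 1), ((2 * n).choose (n + i + 1) : ℤ) * g (i + 1)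
        = ∑ i ∈ range n, ((2 * n).choose (n + i + 1) : ℤ) * g (i + 1) := by
      rw [Finset.sum_range_succ, hz n le_rfl]; simp
    have s3 : ∑ i ∈ range (n + 1), ((2 * n).choose (n + (i + 1) + 1) : ℤ) * g (i + 1)
        + (2 * n).choose (n + 1)
        = ∑ i ∈ range n, ((2 * n).choose (n + i + 1) : ℤ) * g i := by
      have := Finset.sum_range_succ' (fun i => ((2 * n).choose (n + i + 1) : ℤ) * g i) (n + 1)
      rw [Finset.sum_range_succ, Finset.sum_range_succ, hz n le_rfl, hz (n + 1) (by omega)] at this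
      simp only [g0, zero_mul, add_zero, mul_one] at this
      exact this.symm
    have s4 : ∑ i ∈ range n, ((2 * n).choose (n + i + 1) : ℤ) * g (i + 2)
        = (m - 2) * ∑ i ∈ range n, ((2 * n).choose (n + i + 1) : ℤ) * g (i + 1)
          - ∑ i ∈ range n, ((2 * n).choose (n + i + 1) : ℤ) * g i := by
      rw [Finset.mul_sum, ← Finset.sum_sub_distrib]
      refine Finset.sum_congr rfl fun i _ => ?_
      rw [hg]; ring
    have s5 : ∑ i ∈ range (n + 1), ((2 * (n + 1)).choose (n + 1 + i + 1) : ℤ) * g (i + 1)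
        = ∑ i ∈ range (n + 1), ((2 * n).choose (n + i) : ℤ) * g (i + 1)
          + 2 * ∑ i ∈ range (n + 1), ((2 * n).choose (n + i + 1) : ℤ) * g (i + 1)
          + ∑ i ∈ range (n + 1), ((2 * n).choose (n + (i + 1) + 1) : ℤ) * g (i + 1) := by
      rw [Finset.mul_sum, ← Finset.sum_add_distrib, ← Finset.sum_add_distrib]
      refine Finset.sum_congr rfl fun i _ => ?_
      rw [hch]; ring
    rw [hl, ih, s5]
    linear_combination hc - s1 - 2 * s2 - s3 - s4

/-- Since `binom(2p, p+i) ≡ 2 binom(p,i)` for `0 < i < p`, the sum is twice a binomial transform.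
The corrections are the missing term `i = 0` and the term `i = p`, whose coefficient is `1` instead
of `2`. -/
theorem cast_sum_catalan_mul_pow (p : ℕ) [hp : Fact p.Prime] {m : ℤ} {g : ℕ → ℤ} (g0 : g 0 = 1)
    (g1 : g 1 = 1) (hg : ∀ j, g (j + 2) = (m - 2) * g (j + 1) - g j) :
    ((∑ k ∈ range p, (catalan k : ℤ) * m ^ (p - 1 - k) : ℤ) : ZMod (p ^ 2))
      = 2 * binSum g p - 2 - g p := by
  rw [sum_catalan_mul_pow g0 g1 hg, binSum]
  obtain ⟨q, rfl⟩ := Nat.exists_eq_add_of_le' hp.out.one_le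
  rw [Finset.sum_range_succ, Finset.sum_range_succ _ (q + 1), Finset.sum_range_succ']
  have h : ∀ i ∈ range q, (((2 * (q + 1)).choose (q + 1 + i + 1) : ℤ) : ZMod ((q + 1) ^ 2))
      = 2 * (q + 1).choose (i + 1) := fun i hi => by
    have hi := Finset.mem_range.1 hi
    rw [← Nat.choose_symm (show q + 1 + i + 1 ≤ 2 * (q + 1) by omega),
      show 2 * (q + 1) - (q + 1 + i + 1) = q + 1 - (i + 1) by omega, Int.cast_natCast,
      cast_two_mul_prime_choose (q + 1) (by omega) (by omega), Nat.choose_symm (by omega)]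
  push_cast at h ⊢
  rw [Finset.sum_congr rfl (fun i hi => by rw [h i hi]),
    show q + 1 + q + 1 = 2 * (q + 1) by ring, Nat.choose_self, Nat.choose_self, g0]
  simp only [mul_assoc, ← Finset.mul_sum]
  push_cast
  simp
  ring

/-- The sequence `F_{2j-1}`. -/
def fibOdd (j : ℕ) : ℤ := Nat.fib (2 * j + 1) - Nat.fib (2 * j)

/-- The sequence `(-1)^{j-1} L_{2j-1}`. -/
def lucOdd (j : ℕ) : ℤ := (-1) ^ j * (Nat.fib (2 * j + 1) - 3 * Nat.fib (2 * j))

theorem fibOdd_add_two (j : ℕ) : fibOdd (j + 2) = (5 - 2) * fibOdd (j + 1) - fibOdd j := by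
  simp only [fibOdd, mul_add, mul_one, Nat.reduceMul, add_assoc, Nat.reduceAdd]
  rw [cast_fib_add_two (2 * j + 3), cast_fib_add_two (2 * j + 2), cast_fib_add_two (2 * j + 1),
    cast_fib_add_two (2 * j)]
  ring

theorem lucOdd_add_two (j : ℕ) : lucOdd (j + 2) = (-1 - 2) * lucOdd (j + 1) - lucOdd j := by
  simp only [lucOdd, mul_add, mul_one, Nat.reduceMul, add_assoc, Nat.reduceAdd, pow_add]
  rw [cast_fib_add_two (2 * j + 3), cast_fib_add_two (2 * j + 2), cast_fib_add_two (2 * j + 1),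
    cast_fib_add_two (2 * j)]
  ring

/-- With `φ` the golden ratio, the characteristic root `-φ²` satisfies `1 - φ² = -φ`, so the
transform halves the rate of growth. The shift `s` is what the induction through `binSum_succ`
needs. -/
theorem binSum_lucOdd (n : ℕ) : ∀ s, binSum (fun j => lucOdd (j + s)) n
    = (-1) ^ (n + s) * (Nat.fib (n + 2 * s + 1) - 3 * Nat.fib (n + 2 * s)) := by
  induction n with
  | zero => intro s; simp [binSum, lucOdd]
  | succ n ih =>
    intro s
    have h := ih (s + 1)
    rw [binSum_succ, ih s]
    simp only [← add_assoc, add_right_comm _ 1 s] at h ⊢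
    rw [h, show n + 2 * (s + 1) = n + 2 * s + 2 by ring,
      show n + 1 + 2 * s = n + 2 * s + 1 by ring, cast_fib_add_two (n + 2 * s + 1),
      cast_fib_add_two (n + 2 * s), pow_succ]
    ring

/-- Here `1 + φ² = √5 φ`; the powers of `√5` make Fibonacci and Lucas numbers alternate with the
parity of the order, so the induction advances by two. -/
theorem binSum_fibOdd (t : ℕ) : ∀ s, binSum (fun j => fibOdd (j + s)) (2 * t + 1)
    = 5 ^ t * luc (2 * t + 2 * s) := by
  induction t with
  | zero =>
    intro s
    simp only [binSum, mul_zero, zero_add, Nat.reduceAdd, Finset.sum_range_succ, fibOdd, luc,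
      Finset.sum_range_zero, Nat.choose_zero_right, Nat.choose_self, pow_zero, Nat.cast_one,
      one_mul, show 2 * (1 + s) = 2 * s + 2 by ring, add_assoc]
    rw [cast_fib_add_two (2 * s + 1), cast_fib_add_two (2 * s)]
    ring
  | succ t ih =>
    intro s
    have h0 := ih s
    have h1 := ih (s + 1)
    have h2 := ih (s + 2)
    rw [show 2 * (t + 1) + 1 = 2 * t + 1 + 1 + 1 by ring, binSum_succ _ (2 * t + 1 + 1),
      binSum_succ _ (2 * t + 1), binSum_succ _ (2 * t + 1)]
    simp only [← add_assoc, add_right_comm _ 1 s] at h0 h1 h2 ⊢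
    have e : (fun j => fibOdd (j + s + 1 + 1)) = fun j => fibOdd (j + s + 2) := rfl
    rw [h0, h1, e, h2, show 2 * t + 2 * (s + 1) = 2 * t + 2 * s + 2 by ring,
      show 2 * t + 2 * (s + 2) = 2 * t + 2 * s + 2 + 2 by ring,
      show 2 * (t + 1) + 2 * s = 2 * t + 2 * s + 2 by ring, luc_add_two (2 * t + 2 * s + 2),
      luc_add_two (2 * t + 2 * s),
      show 2 * t + 2 * s + 2 + 1 = 2 * t + 2 * s + 1 + 2 by ring, luc_add_two (2 * t + 2 * s + 1),
      show 2 * t + 2 * s + 1 + 1 = 2 * t + 2 * s + 2 by ring, luc_add_two (2 * t + 2 * s), pow_succ]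
    ring

/-! ### Sums of `binom(p,k+1)/p · C_k` modulo `p` -/

/-- A formal antiderivative of `((1+x)^N - 1)/x = ∑_{j<N} (1+x)^j`. Only the denominators that occur
are assumed nonzero, so that it applies in characteristic `p`. -/
theorem sum_choose_mul_pow_div {K : Type*} [Field K] (t : K) (N : ℕ)
    (hN : ∀ j < N, ((j : K) + 1) ≠ 0) :
    ∑ k ∈ range N, (N.choose (k + 1) : K) * t ^ (k + 1) / (k + 1)
      = ∑ j ∈ range N, ((1 + t) ^ (j + 1) - 1) / ((j : K) + 1) := by
  induction N with
  | zero => simp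
  | succ N ih =>
    have hN1 : ((N : K) + 1) ≠ 0 := hN N (Nat.lt_succ_self N)
    have h1 : ∑ k ∈ range (N + 1), (N.choose (k + 1) : K) * t ^ (k + 1) / (k + 1)
        = ∑ k ∈ range N, (N.choose (k + 1) : K) * t ^ (k + 1) / (k + 1) := by
      rw [Finset.sum_range_succ, Nat.choose_succ_self]; simp
    have h2 : ∑ k ∈ range (N + 1), (N.choose k : K) * t ^ (k + 1) / (k + 1)
        = ((1 + t) ^ (N + 1) - 1) / ((N : K) + 1) := by
      rw [add_comm (1 : K) t, add_pow, Finset.sum_range_succ' _ (N + 1)]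
      simp only [one_pow, mul_one, pow_zero, Nat.choose_zero_right, Nat.cast_one,
        add_sub_cancel_right]
      rw [Finset.sum_div]
      refine Finset.sum_congr rfl fun k hk => ?_
      have hk1 := hN k (Finset.mem_range.1 hk)
      have h : ((N : K) + 1) * N.choose k = (N + 1).choose (k + 1) * (k + 1) := by
        exact_mod_cast congrArg (Nat.cast : ℕ → K) (Nat.add_one_mul_choose_eq N k)
      rw [div_eq_div_iff hk1 hN1]
      linear_combination t ^ (k + 1) * h
    rw [Finset.sum_range_succ (fun j : ℕ => ((1 + t) ^ (j + 1) - 1) / ((j : K) + 1)) N,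
      ← ih fun j hj => hN j (by omega), ← h1, ← h2,
      ← Finset.sum_add_distrib]
    refine Finset.sum_congr rfl fun k _ => ?_
    rw [Nat.choose_succ_succ]
    push_cast
    ring

/-- From `√(1-4x) = 1 - 2 ∑ C_k x^(k+1)` one has `-2 C_k = (-4)^(k+1) binom(1/2, k+1)`, and `1/2` is
`m+1` modulo `p`. The proof compares consecutive ratios. -/
theorem neg_two_mul_cast_catalan {p m : ℕ} [hp : Fact p.Prime] (hm : p = 2 * m + 1) {k : ℕ}
    (hk : k + 1 < p) :
    (-2 : ZMod p) * catalan k = (-4) ^ (k + 1) * (m + 1).choose (k + 1) := by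
  have hp0 : 2 * (m : ZMod p) + 1 = 0 := by
    have : ((2 * m + 1 : ℕ) : ZMod p) = 0 := by rw [← hm]; exact ZMod.natCast_self p
    exact_mod_cast this
  induction k with
  | zero =>
    simp
    linear_combination -2 * hp0
  | succ k ih =>
    have ih := ih (by omega)
    have h0 : ((k : ZMod p) + 2) ≠ 0 := by
      exact_mod_cast cast_ne_zero_of_lt p (Nat.succ_ne_zero (k + 1)) (show k + 1 + 1 < p by omega)
    have h1 : ((k : ℤ) + 2) * catalan (k + 1) = 2 * (2 * k + 1) * catalan k := by
      have := (centralBinom_eq_mul_catalan (k + 1)).symm.trans (centralBinom_succ_eq_mul_catalan k)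
      zify at this
      linear_combination this
    have h2 : ((m + 1).choose (k + 2) : ℤ) * (k + 2) = (m + 1).choose (k + 1) * ((m : ℤ) - k) := by
      have h := cast_choose_succ (m + 1) (k + 1)
      have h' : (((m + 1).choose (k + 2) : ℤ) : ℚ) * ((k : ℤ) + 2)
          = ((m + 1).choose (k + 1) : ℤ) * (((m : ℤ) : ℚ) - (k : ℤ)) := by
        push_cast at h ⊢
        linear_combination h
      exact_mod_cast h'
    apply_fun (Int.cast : ℤ → ZMod p) at h1 h2
    push_cast at h1 h2
    refine mul_left_cancel₀ h0 ?_
    rw [show k + 1 + 1 = k + 2 by ring, pow_succ (-4 : ZMod p) (k + 1)]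
    linear_combination -2 * h1 + 2 * (2 * (k : ZMod p) + 1) * ih + 4 * (-4) ^ (k + 1) * h2
      + 2 * (-4) ^ (k + 1) * (m + 1).choose (k + 1) * hp0

/-- The sum `∑ C_k y^{k+1} / (k+1)` in `ZMod p`. -/
theorem sum_catalan_mul_pow_div {p m : ℕ} [hp : Fact p.Prime] (hm : p = 2 * m + 1)
    (y : ZMod p) :
    ∑ k ∈ range (p - 1), (catalan k : ZMod p) * y ^ (k + 1) / (k + 1)
      = ∑ j ∈ range m, (chooseQuot p (2 * (j + 1)) : ZMod p) * ((1 - 4 * y) ^ (j + 1) - 1)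
        - ((1 - 4 * y) ^ (m + 1) - 1) := by
  have hm0 : m ≠ 0 := fun h => hp.out.ne_one (by rw [hm, h])
  have hp0 : 2 * (m : ZMod p) + 1 = 0 := by
    have : ((2 * m + 1 : ℕ) : ZMod p) = 0 := by rw [← hm]; exact ZMod.natCast_self p
    exact_mod_cast this
  have h2 : (2 : ZMod p) ≠ 0 := by
    exact_mod_cast cast_ne_zero_of_lt p two_ne_zero (by omega)
  have hne : ∀ j < p - 1, ((j : ZMod p) + 1) ≠ 0 := fun j hj => by
    exact_mod_cast cast_ne_zero_of_lt p (Nat.succ_ne_zero j) (by omega)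
  have e1 : ∑ k ∈ range (p - 1), (catalan k : ZMod p) * y ^ (k + 1) / (k + 1)
      = -(1 / 2) * ∑ k ∈ range (p - 1),
        ((m + 1).choose (k + 1) : ZMod p) * (-4 * y) ^ (k + 1) / (k + 1) := by
    rw [Finset.mul_sum]
    refine Finset.sum_congr rfl fun k hk => ?_
    have hk := Finset.mem_range.1 hk
    have h := neg_two_mul_cast_catalan hm (show k + 1 < p by omega)
    have hk0 := hne k hk
    rw [mul_pow]
    field_simp
    linear_combination -y ^ (k + 1) * h
  have e2 : ∑ k ∈ range (p - 1), ((m + 1).choose (k + 1) : ZMod p) * (-4 * y) ^ (k + 1) / (k + 1)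
      = ∑ k ∈ range (m + 1), ((m + 1).choose (k + 1) : ZMod p) * (-4 * y) ^ (k + 1) / (k + 1) := by
    symm
    refine Finset.sum_subset (Finset.range_subset_range.2 (by omega)) fun k _ hk => ?_
    have : m + 1 ≤ k := by simpa using hk
    rw [Nat.choose_eq_zero_of_lt (by omega)]
    simp
  have hm1 : ((m : ZMod p) + 1) ≠ 0 := hne m (by omega)
  -- `binom(p, 2i)/p` is `-1/(2i)` modulo `p`. The term `j = m` is kept apart because its index
  -- `p+1` is out of range; there `1/(m+1) = 2`.
  have e3 : ∑ j ∈ range m, ((1 - 4 * y) ^ (j + 1) - 1) / ((j : ZMod p) + 1)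
      = -2 * ∑ j ∈ range m,
        (chooseQuot p (2 * (j + 1)) : ZMod p) * ((1 - 4 * y) ^ (j + 1) - 1) := by
    rw [Finset.mul_sum]
    refine Finset.sum_congr rfl fun j hj => ?_
    have hj := Finset.mem_range.1 hj
    have h := cast_succ_mul_chooseQuot p (show 2 * j + 1 + 1 < p by omega)
    have hj0 := hne j (by omega)
    rw [pow_succ, pow_mul, neg_one_sq, one_pow] at h
    push_cast at h
    rw [show 2 * j + 1 + 1 = 2 * (j + 1) by ring] at h
    rw [div_eq_iff hj0]
    linear_combination ((1 - 4 * y) ^ (j + 1) - 1) * h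
  have e4 : ((1 - 4 * y) ^ (m + 1) - 1) / ((m : ZMod p) + 1) = 2 * ((1 - 4 * y) ^ (m + 1) - 1) := by
    rw [div_eq_iff hm1]
    linear_combination -((1 - 4 * y) ^ (m + 1) - 1) * hp0
  rw [e1, e2, sum_choose_mul_pow_div _ _ fun j hj => hne j (by omega),
    show 1 + -4 * y = 1 - 4 * y by ring, Finset.sum_range_succ, e3, e4]
  field_simp
  ring

theorem cast_chooseQuot_succ {p : ℕ} [Fact p.Prime] {k : ℕ} (hk : k + 1 < p) :
    (chooseQuot p (k + 1) : ZMod p) = (-1) ^ k / (k + 1) := by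
  have h0 : ((k : ZMod p) + 1) ≠ 0 := by
    exact_mod_cast cast_ne_zero_of_lt p (Nat.succ_ne_zero k) hk
  rw [eq_div_iff h0, mul_comm, cast_succ_mul_chooseQuot p hk]

theorem chooseQuot_symm {p k : ℕ} (hk : k ≤ p) : chooseQuot p (p - k) = chooseQuot p k := by
  rw [chooseQuot, Nat.choose_symm hk, chooseQuot]

theorem mul_sum_chooseQuot_even_five {p m : ℕ} [hp : Fact p.Prime] (hm : p = 2 * m + 1) :
    (p : ℤ) * ∑ j ∈ range m, (chooseQuot p (2 * (j + 1)) : ℤ) * 5 ^ (j + 1)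
      = 2 ^ (2 * m) * luc p - 1 := by
  have h := sum_choose_even_five m
  rw [Finset.sum_range_succ', ← hm] at h
  simp only [mul_zero, Nat.choose_zero_right, pow_zero, Nat.cast_one, mul_one] at h
  rw [← h, add_sub_cancel_right, Finset.mul_sum]
  refine Finset.sum_congr rfl fun j hj => ?_
  have hj := Finset.mem_range.1 hj
  rw [← mul_chooseQuot p (show 2 * (j + 1) ≠ 0 by omega) (by omega)]
  push_cast
  ring

theorem mul_sum_chooseQuot_even {p m : ℕ} [hp : Fact p.Prime] (hm : p = 2 * m + 1) :
    (p : ℤ) * ∑ j ∈ range m, (chooseQuot p (2 * (j + 1)) : ℤ) = 2 ^ (2 * m) - 1 := by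
  have h := sum_choose_even m
  rw [Finset.sum_range_succ', ← hm] at h
  simp only [mul_zero, Nat.choose_zero_right, Nat.cast_one] at h
  rw [← h, add_sub_cancel_right, Finset.mul_sum]
  refine Finset.sum_congr rfl fun j hj => ?_
  have hj := Finset.mem_range.1 hj
  rw [← mul_chooseQuot p (show 2 * (j + 1) ≠ 0 by omega) (by omega)]
  push_cast
  ring

theorem mul_sum_chooseQuot_odd_five {p m : ℕ} [hp : Fact p.Prime] (hm : p = 2 * m + 1) :
    (p : ℤ) * ∑ j ∈ range m, (chooseQuot p (2 * j + 1) : ℤ) * 5 ^ j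
      = 2 ^ (2 * m) * Nat.fib p - 5 ^ m := by
  have h := sum_choose_odd_five m
  rw [Finset.sum_range_succ, ← hm] at h
  simp only [Nat.choose_self, Nat.cast_one, one_mul] at h
  rw [← h, add_sub_cancel_right, Finset.mul_sum]
  refine Finset.sum_congr rfl fun j hj => ?_
  have hj := Finset.mem_range.1 hj
  rw [← mul_chooseQuot p (show 2 * j + 1 ≠ 0 by omega) (by omega)]
  push_cast
  ring

theorem cast_sum_chooseQuot_mul_catalan {p m : ℕ} [hp : Fact p.Prime] (hm : p = 2 * m + 1) :
    ((∑ k ∈ range (p - 1), (chooseQuot p (k + 1) : ℤ) * catalan k : ℤ) : ZMod p)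
      = ((-(∑ j ∈ range m, (chooseQuot p (2 * (j + 1)) : ℤ) * 5 ^ (j + 1))
        + ∑ j ∈ range m, (chooseQuot p (2 * (j + 1)) : ℤ) + (5 * 5 ^ m - 1) : ℤ) : ZMod p) := by
  have h := sum_catalan_mul_pow_div hm (-1)
  have e : ∑ k ∈ range (p - 1), (chooseQuot p (k + 1) : ZMod p) * catalan k
      = -∑ k ∈ range (p - 1), (catalan k : ZMod p) * (-1) ^ (k + 1) / (k + 1) := by
    rw [← Finset.sum_neg_distrib]
    refine Finset.sum_congr rfl fun k hk => ?_
    have hk := Finset.mem_range.1 hk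
    rw [cast_chooseQuot_succ (by omega), pow_succ]
    ring
  push_cast
  rw [e, h, show (1 - 4 * (-1) : ZMod p) = 5 by norm_num]
  simp only [mul_sub, mul_one, Finset.sum_sub_distrib]
  ring

theorem cast_sum_chooseQuot_mul_catalan_five {p m : ℕ} [hp : Fact p.Prime] (hm : p = 2 * m + 1)
    (h5 : p ≠ 5) :
    ((∑ k ∈ range (p - 1), (-1) ^ k * (chooseQuot p (k + 1) : ℤ) * catalan k * 5 ^ (p - 1 - k)
        : ℤ) : ZMod p)
      = ((5 * (5 ^ m * (∑ j ∈ range m, (chooseQuot p (2 * j + 1) : ℤ) * 5 ^ j)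
        - ∑ j ∈ range m, (chooseQuot p (2 * (j + 1)) : ℤ)) - 5 ^ m + 5 : ℤ) : ZMod p) := by
  have h50 : (5 : ZMod p) ≠ 0 := by
    have : ¬ p ∣ 5 := fun h => h5 ((Nat.prime_dvd_prime_iff_eq hp.out (by norm_num)).1 h)
    have h := (ZMod.natCast_eq_zero_iff 5 p).not.2 this
    exact_mod_cast h
  have hf : (5 : ZMod p) ^ (p - 1) = 1 := ZMod.pow_card_sub_one_eq_one h50
  have hfm : (5 : ZMod p) ^ m * 5 ^ m = 1 := by
    rw [← pow_add, show m + m = p - 1 by omega, hf]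
  have h := sum_catalan_mul_pow_div hm (5⁻¹)
  have e : ∑ k ∈ range (p - 1), (-1) ^ k * (chooseQuot p (k + 1) : ZMod p) * catalan k
        * 5 ^ (p - 1 - k)
      = 5 * ∑ k ∈ range (p - 1), (catalan k : ZMod p) * (5⁻¹) ^ (k + 1) / (k + 1) := by
    rw [Finset.mul_sum]
    refine Finset.sum_congr rfl fun k hk => ?_
    have hk := Finset.mem_range.1 hk
    have hs : ((-1 : ZMod p) ^ k) * (-1) ^ k = 1 := by rw [← mul_pow]; simp
    rw [cast_chooseQuot_succ (by omega), pow_sub₀ _ h50 hk.le, hf, pow_succ (5⁻¹ : ZMod p),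
      inv_pow]
    have hk0 : ((k : ZMod p) + 1) ≠ 0 := by
      exact_mod_cast cast_ne_zero_of_lt p (Nat.succ_ne_zero k) (show k + 1 < p by omega)
    field_simp
    linear_combination (catalan k : ZMod p) * hs
  -- Reflection through `binom(p,i) = binom(p,p-i)` exchanges even and odd indices and trades powers
  -- of `5⁻¹` for powers of `5`, so this sum is a Fibonacci number instead of a Lucas number.
  have e2 : ∑ j ∈ range m, (chooseQuot p (2 * (j + 1)) : ZMod p) * (5⁻¹) ^ (j + 1)
      = 5 ^ m * ∑ j ∈ range m, (chooseQuot p (2 * j + 1) : ZMod p) * 5 ^ j := by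
    rw [← Finset.sum_range_reflect, Finset.mul_sum]
    refine Finset.sum_congr rfl fun j hj => ?_
    have hj := Finset.mem_range.1 hj
    rw [show 2 * (m - 1 - j + 1) = p - (2 * j + 1) by omega, chooseQuot_symm (by omega),
      show m - 1 - j + 1 = m - j by omega, inv_pow, pow_sub₀ _ h50 hj.le, mul_inv, inv_inv,
      inv_eq_of_mul_eq_one_right hfm]
    ring
  push_cast
  rw [e, h, show (1 - 4 * 5⁻¹ : ZMod p) = 5⁻¹ by field_simp; norm_num]
  simp only [mul_sub, mul_one, Finset.sum_sub_distrib]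
  rw [e2, inv_pow, pow_succ, mul_inv, inv_eq_of_mul_eq_one_right hfm]
  field_simp
  ring

/-! ### Assembly modulo `p²` -/

/-- The final computation for the pair `(5,5)`, over a ring where products of multiples of `p`
vanish. Here `x, y, a` are `F_p, L_p, F_{p+1}`, `e` is the Legendre symbol, `P = F_p - e`, `Z =
2^(p-1)`, `h = 5^m`, and `f` is the Fibonacci number of index `p - e`. -/
theorem algebra_one {R : Type*} [CommRing R] {p P Z x y a f e h S : R}
    (hpp : p * p = 0) (hpP : p * P = 0) (hPP : P * P = 0) (hZ : Z * P = P) (hh : p * h = p * e)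
    (he : e = 1 ∨ e = -1) (h2 : IsUnit (2 : R)) (hx : x = e + P) (hy : y = 1 + 5 * e * P)
    (ha : 2 * a = x + y) (hf : 2 * f = y - e * x)
    (hS : S = (1 - p) * ((2 * -(a - 3 * x) - 2 - -(a ^ 2 + x ^ 2 - 3 * (x * y))) + (1 + 2 * p))
      + (-(Z * y - 1) + (Z - 1) + p * (5 * h - 1)) - 2 * (1 - p) * (1 + 2 * p)) :
    2 * S = 5 * (e - 1) + p * (5 * e - 1) - 5 * (1 + 2 * e) * f := by
  subst hx hy hS
  rcases he with rfl | rfl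
  · have ha' : a = 1 + 3 * P := h2.mul_left_cancel (by linear_combination ha)
    have hf' : f = 2 * P := h2.mul_left_cancel (by linear_combination hf)
    subst ha' hf'
    grind
  · have ha' : a = -2 * P := h2.mul_left_cancel (by linear_combination ha)
    have hf' : f = -2 * P := h2.mul_left_cancel (by linear_combination hf)
    subst ha' hf'
    grind

/-- The analogue for `(1,-1)`, with `H = 5^m - e` and `z = 2^(p-1) - 1`. Squaring `5^m` identifies
`p q` with `2eH`, which is how the Fermat quotient enters. -/
theorem algebra_five {R : Type*} [CommRing R] {p P H z x y a f e h q S : R}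
    (hpp : p * p = 0) (hpP : p * P = 0) (hPP : P * P = 0) (hpH : p * H = 0) (hPH : P * H = 0)
    (hHH : H * H = 0) (hzP : z * P = 0) (hzH : z * H = 0)
    (he : e = 1 ∨ e = -1) (h2 : IsUnit (2 : R)) (hx : x = e + P) (hy : y = 1 + 5 * e * P)
    (hh : h = e + H)
    (ha : 2 * a = x + y) (hf : 2 * f = y - e * x) (hq : h * h = 1 + p * q)
    (hS : S = (1 - p) * ((2 * (h * (2 * x - (a - x))) - 2 - (a ^ 2 + x ^ 2 - x * y)) + (1 + 2 * p))
      + (5 * (h * ((1 + z) * x - h) - z) - p * h + 5 * p) - 2 * (1 - p) * (1 + 2 * p)) :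
    2 * S = h * h * ((1 - e) + p * (5 - e - q) + (5 - 2 * e) * f) := by
  subst hx hy hS hh
  rcases he with rfl | rfl
  · have ha' : a = 1 + 3 * P := h2.mul_left_cancel (by linear_combination ha)
    have hf' : f = 2 * P := h2.mul_left_cancel (by linear_combination hf)
    have hq' : p * q = 2 * H := by linear_combination -hq + hHH
    subst ha' hf'
    grind
  · have ha' : a = -2 * P := h2.mul_left_cancel (by linear_combination ha)
    have hf' : f = -2 * P := h2.mul_left_cancel (by linear_combination hf)
    have hq' : p * q = -2 * H := by linear_combination -hq + hHH
    subst ha' hf'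
    grind

/-- The residues of the Fibonacci and Lucas numbers of prime index modulo the prime. -/
theorem prime_residues {p m : ℕ} [hp : Fact p.Prime] (hm : p = 2 * m + 1) (h5 : p ≠ 5) :
    (legendreSym 5 (p : ℤ) = 1 ∨ legendreSym 5 (p : ℤ) = -1) ∧
    (p : ℤ) ∣ 5 ^ m - legendreSym 5 (p : ℤ) ∧
    (p : ℤ) ∣ Nat.fib p - legendreSym 5 (p : ℤ) ∧ (p : ℤ) ∣ luc p - 1 := by
  have hp5 : ¬ p ∣ 5 := fun h => h5 ((Nat.prime_dvd_prime_iff_eq hp.out (by norm_num)).1 h)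
  have he : legendreSym 5 (p : ℤ) = legendreSym p 5 := by
    have hm0 : m ≠ 0 := fun h => hp.out.ne_one (by rw [hm, h])
    have := legendreSym.quadratic_reciprocity_one_mod_four (p := 5) (q := p) (by norm_num)
      (by omega)
    rw [← this]
    rfl
  have h1 : (p : ℤ) ∣ 5 ^ m - legendreSym 5 (p : ℤ) := by
    rw [← ZMod.intCast_eq_intCast_iff_dvd_sub, he, legendreSym.eq_pow,
      show p / 2 = m by omega]
    push_cast
    rfl
  have hZ := mul_sum_chooseQuot_even hm
  have hL := mul_sum_chooseQuot_even_five hm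
  have hF := mul_sum_chooseQuot_odd_five hm
  refine ⟨?_, h1, ?_, ?_⟩
  · rw [he]
    refine legendreSym.eq_one_or_neg_one p ?_
    have := (ZMod.natCast_eq_zero_iff 5 p).not.2 hp5
    exact_mod_cast this
  -- In the formula for `2^(p-1) F_p - 5^m`, substitute `2^(p-1) = 1 + p Z` to exhibit `F_p - 5^m`
  -- as a multiple of `p`; the Lucas case is the same.
  · have : (Nat.fib p : ℤ) - legendreSym 5 (p : ℤ) = (5 ^ m - legendreSym 5 (p : ℤ))
        + p * ((∑ j ∈ range m, (chooseQuot p (2 * j + 1) : ℤ) * 5 ^ j)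
          - Nat.fib p * ∑ j ∈ range m, (chooseQuot p (2 * (j + 1)) : ℤ)) := by
      linear_combination (Nat.fib p : ℤ) * hZ - hF
    rw [this]
    exact dvd_add h1 (dvd_mul_right _ _)
  · have : luc p - 1 = p * ((∑ j ∈ range m, (chooseQuot p (2 * (j + 1)) : ℤ) * 5 ^ (j + 1))
          - luc p * ∑ j ∈ range m, (chooseQuot p (2 * (j + 1)) : ℤ)) := by
      linear_combination luc p * hZ - hL
    rw [this]
    exact dvd_mul_right _ _

theorem two_mul_fib_fibIndex {p : ℕ} (hp : 1 ≤ p)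
    (he : legendreSym 5 (p : ℤ) = 1 ∨ legendreSym 5 (p : ℤ) = -1) :
    2 * (Nat.fib (fibIndex p) : ℤ) = luc p - legendreSym 5 (p : ℤ) * Nat.fib p := by
  obtain ⟨q, rfl⟩ := Nat.exists_eq_add_of_le' hp
  rw [fibIndex, luc]
  rcases he with he | he
  · rw [he, show (((q + 1 : ℕ) : ℤ) - 1).toNat = q by omega, cast_fib_add_two]
    ring
  · rw [he, show (((q + 1 : ℕ) : ℤ) - -1).toNat = q + 2 by omega, cast_fib_add_two]
    ring

/-- `L_p² - 5 F_p² = -4` for odd `p` ties the first-order terms together: writing `L_p = 1 + pl`, it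
gives `l ≡ 5eφ` modulo `p`. -/
theorem prime_expansions {p m : ℕ} [hp : Fact p.Prime] (hm : p = 2 * m + 1) (h5 : p ≠ 5) :
    ∃ φ η : ℤ, (5 : ℤ) ^ m = legendreSym 5 (p : ℤ) + p * η ∧
      (Nat.fib p : ℤ) = legendreSym 5 (p : ℤ) + p * φ ∧
      (luc p : ZMod (p ^ 2)) = 1 + 5 * (legendreSym 5 (p : ℤ) : ZMod (p ^ 2)) * (p * φ) := by
  obtain ⟨he, ⟨η, hη⟩, ⟨φ, hφ⟩, ⟨l, hl⟩⟩ := prime_residues hm h5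
  refine ⟨φ, η, by linear_combination hη, by linear_combination hφ, ?_⟩
  set e := legendreSym 5 (p : ℤ)
  have hee : e * e = 1 := by rcases he with h | h <;> rw [h] <;> norm_num
  have hp0 : (p : ℤ) ≠ 0 := by exact_mod_cast hp.out.ne_zero
  have hsq := luc_sq p
  rw [Odd.neg_one_pow ⟨m, hm⟩, show luc p = 1 + p * l by linear_combination hl,
    show (Nat.fib p : ℤ) = e + p * φ by linear_combination hφ] at hsq
  have hc : 2 * l + p * l ^ 2 = 10 * e * φ + 5 * p * φ ^ 2 := by
    refine mul_left_cancel₀ hp0 ?_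
    linear_combination hsq + 5 * hee
  apply_fun (Int.cast : ℤ → ZMod (p ^ 2)) at hc hl
  push_cast at hc hl
  have h2 := isUnit_two p (by omega)
  refine h2.mul_left_cancel ?_
  linear_combination 2 * hl + (p : ZMod (p ^ 2)) * hc
    + (5 * (φ : ZMod (p ^ 2)) ^ 2 - (l : ZMod (p ^ 2)) ^ 2) * cast_prime_sq p

/-- The term `k = p-1` is exceptional: there `w ≡ 2(1-p)` and `C_{p-1} ≡ -(1+2p)`. The alternating
sum is completed to the full range, where its closed form is known, and its last term is
compensated. -/
theorem cast_sum_wInt_mul (p : ℕ) [hp : Fact p.Prime] (h2 : p ≠ 2) (f : ℕ → ZMod (p ^ 2)) :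
    ∑ k ∈ range p, (wInt p k : ZMod (p ^ 2)) * (catalan k : ZMod (p ^ 2)) * f k
      = (1 - (p : ZMod (p ^ 2))) * (∑ k ∈ range p,
            (-1 : ZMod (p ^ 2)) ^ k * (catalan k : ZMod (p ^ 2)) * f k
          + (-1 : ZMod (p ^ 2)) ^ (p - 1) * (1 + 2 * (p : ZMod (p ^ 2))) * f (p - 1))
        + (p : ZMod (p ^ 2)) * ∑ k ∈ range (p - 1),
            (chooseQuot p (k + 1) : ZMod (p ^ 2)) * (catalan k : ZMod (p ^ 2)) * f k
        - 2 * (1 - (p : ZMod (p ^ 2))) * (1 + 2 * (p : ZMod (p ^ 2))) * f (p - 1) := by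
  have hr : ∀ g : ℕ → ZMod (p ^ 2), ∑ k ∈ range p, g k = ∑ k ∈ range (p - 1), g k + g (p - 1) := by
    intro g
    rw [← Finset.sum_range_succ, Nat.sub_add_cancel hp.out.one_le]
  rw [hr, hr (fun k => (-1 : ZMod (p ^ 2)) ^ k * (catalan k : ZMod (p ^ 2)) * f k),
    cast_wInt_prime_last,
    cast_catalan_prime_sub_one p h2]
  have h : ∑ k ∈ range (p - 1), (wInt p k : ZMod (p ^ 2)) * (catalan k : ZMod (p ^ 2)) * f k
      = (1 - (p : ZMod (p ^ 2))) * ∑ k ∈ range (p - 1),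
            (-1 : ZMod (p ^ 2)) ^ k * (catalan k : ZMod (p ^ 2)) * f k
        + (p : ZMod (p ^ 2)) * ∑ k ∈ range (p - 1),
            (chooseQuot p (k + 1) : ZMod (p ^ 2)) * (catalan k : ZMod (p ^ 2)) * f k := by
    rw [Finset.mul_sum, Finset.mul_sum, ← Finset.sum_add_distrib]
    refine Finset.sum_congr rfl fun k hk => ?_
    have hk := Finset.mem_range.1 hk
    have hk1 : k + 1 < p := by omega
    rw [cast_wInt_prime p hk1, ← mul_chooseQuot p (Nat.succ_ne_zero k) hk1]
    push_cast
    ring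
  rw [h]
  ring

theorem two_mul_cast_sum_one {p m : ℕ} [hp : Fact p.Prime] (hm : p = 2 * m + 1) (h5 : p ≠ 5) :
    2 * ((∑ k ∈ range p, wInt p k * catalan k : ℤ) : ZMod (p ^ 2))
      = 5 * ((legendreSym 5 (p : ℤ) : ZMod (p ^ 2)) - 1)
        + p * (5 * (legendreSym 5 (p : ℤ) : ZMod (p ^ 2)) - 1)
        - 5 * (1 + 2 * (legendreSym 5 (p : ℤ) : ZMod (p ^ 2))) * Nat.fib (fibIndex p) := by
  obtain ⟨he, -⟩ := prime_residues hm h5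
  obtain ⟨φ, η, hη, hφ, hl⟩ := prime_expansions hm h5
  have hpp := cast_prime_sq p
  have hf := two_mul_fib_fibIndex hp.out.one_le he
  have ha := two_mul_fib_succ p
  have hB := cast_prime_mul_eq (cast_sum_chooseQuot_mul_catalan hm)
  have hL := mul_sum_chooseQuot_even_five hm
  have hZ := mul_sum_chooseQuot_even hm
  have hA := cast_sum_catalan_mul_pow p (m := -1) (g := lucOdd) (by simp [lucOdd])
    (by norm_num [lucOdd, Nat.fib_add_two]) lucOdd_add_two
  have hS := binSum_lucOdd p 0
  -- The doubling formulas bring index `2p` back to index `p`, where residues modulo `p²` are under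
  -- control.
  have hg : lucOdd p = -(Nat.fib (p + 1) ^ 2 + Nat.fib p ^ 2 - 3 * (Nat.fib p * luc p)) := by
    have h1 : (Nat.fib (2 * p) : ℤ) = Nat.fib p * luc p := by
      rw [Nat.fib_two_mul]
      have : Nat.fib p ≤ 2 * Nat.fib (p + 1) := by
        have := Nat.fib_le_fib_succ (n := p)
        omega
      push_cast [this]
      rfl
    rw [lucOdd, Odd.neg_one_pow ⟨m, hm⟩, h1, Nat.fib_two_mul_add_one]
    push_cast
    ring
  simp only [add_zero, mul_zero, Odd.neg_one_pow ⟨m, hm⟩] at hS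
  have hmain := cast_sum_wInt_mul p (by omega) (fun _ => 1)
  have hAc : ∑ k ∈ range p, (-1 : ZMod (p ^ 2)) ^ k * (catalan k : ZMod (p ^ 2)) * 1
      = 2 * binSum lucOdd p - 2 - lucOdd p := by
    rw [← hA]
    push_cast
    refine Finset.sum_congr rfl fun k hk => ?_
    have hk := Finset.mem_range.1 hk
    have : (-1 : ZMod (p ^ 2)) ^ (p - 1 - k) = (-1) ^ k := by
      rw [neg_one_pow_eq_pow_mod_two, neg_one_pow_eq_pow_mod_two (n := k)]
      congr 1
      omega
    rw [this]
    ring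
  have hev : (-1 : ZMod (p ^ 2)) ^ (p - 1) = 1 := Even.neg_one_pow ⟨m, by omega⟩
  rw [hAc, hev, hS, hg] at hmain
  apply_fun (Int.cast : ℤ → ZMod (p ^ 2)) at hη hφ hf ha hL hZ
  push_cast at hη hφ hf ha hL hZ hB hmain ⊢
  simp only [mul_one] at hmain
  refine algebra_one (p := (p : ZMod (p ^ 2))) (P := p * φ) (Z := 2 ^ (2 * m))
    (x := Nat.fib p) (y := luc p) (a := Nat.fib (p + 1)) (h := 5 ^ m) hpp ?_ ?_ ?_ ?_ ?_
    (isUnit_two p (by omega)) hφ hl ha hf ?_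
  · linear_combination (φ : ZMod (p ^ 2)) * hpp
  · linear_combination (φ : ZMod (p ^ 2)) ^ 2 * hpp
  · linear_combination (φ : ZMod (p ^ 2))
      * (∑ j ∈ range m, (chooseQuot p (2 * (j + 1)) : ZMod (p ^ 2))) * hpp
      - (p : ZMod (p ^ 2)) * φ * hZ
  · linear_combination (p : ZMod (p ^ 2)) * hη + (η : ZMod (p ^ 2)) * hpp
  · rcases he with h | h <;> rw [h] <;> simp
  · rw [hmain, hB]
    linear_combination hZ - hL

theorem two_mul_cast_sum_neg_one {p m : ℕ} [hp : Fact p.Prime] (hm : p = 2 * m + 1) (h5 : p ≠ 5)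
    {q : ℤ} (hq : 5 ^ (p - 1) = 1 + p * q) :
    2 * ((∑ k ∈ range p, (-1) ^ k * wInt p k * catalan k * 5 ^ (p - 1 - k) : ℤ) : ZMod (p ^ 2))
      = 5 ^ (p - 1) * ((1 - (legendreSym 5 (p : ℤ) : ZMod (p ^ 2)))
        + p * (5 - (legendreSym 5 (p : ℤ) : ZMod (p ^ 2)) - q)
        + (5 - 2 * (legendreSym 5 (p : ℤ) : ZMod (p ^ 2))) * Nat.fib (fibIndex p)) := by
  obtain ⟨he, -⟩ := prime_residues hm h5
  obtain ⟨φ, η, hη, hφ, hl⟩ := prime_expansions hm h5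
  have hpp := cast_prime_sq p
  have hf := two_mul_fib_fibIndex hp.out.one_le he
  have ha := two_mul_fib_succ p
  have hB := cast_prime_mul_eq (cast_sum_chooseQuot_mul_catalan_five hm h5)
  have hF := mul_sum_chooseQuot_odd_five hm
  have hZ := mul_sum_chooseQuot_even hm
  have hA := cast_sum_catalan_mul_pow p (m := 5) (g := fibOdd) (by simp [fibOdd])
    (by norm_num [fibOdd, Nat.fib_add_two]) fibOdd_add_two
  have hS := binSum_fibOdd m 0
  have hluc : luc (2 * m) = 2 * Nat.fib p - (Nat.fib (p + 1) - Nat.fib p) := by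
    rw [hm, luc, show 2 * m + 1 + 1 = 2 * m + 2 by ring, cast_fib_add_two]
    ring
  have hg : fibOdd p = Nat.fib (p + 1) ^ 2 + Nat.fib p ^ 2 - Nat.fib p * luc p := by
    have h1 : (Nat.fib (2 * p) : ℤ) = Nat.fib p * luc p := by
      rw [Nat.fib_two_mul]
      have : Nat.fib p ≤ 2 * Nat.fib (p + 1) := by
        have := Nat.fib_le_fib_succ (n := p)
        omega
      push_cast [this]
      rfl
    rw [fibOdd, h1, Nat.fib_two_mul_add_one]
    push_cast
    ring
  simp only [add_zero, mul_zero, ← hm] at hS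
  rw [hluc] at hS
  have hev : (-1 : ZMod (p ^ 2)) ^ (p - 1) = 1 := Even.neg_one_pow ⟨m, by omega⟩
  have hmain := cast_sum_wInt_mul p (by omega) (fun k => (-1) ^ k * 5 ^ (p - 1 - k))
  have hsq : ∀ k : ℕ, (-1 : ZMod (p ^ 2)) ^ k * (-1) ^ k = 1 := fun k => by
    rw [← mul_pow]; simp
  have hAc : ∑ k ∈ range p, (-1 : ZMod (p ^ 2)) ^ k * catalan k * ((-1) ^ k * 5 ^ (p - 1 - k))
      = 2 * binSum fibOdd p - 2 - fibOdd p := by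
    rw [← hA]
    push_cast
    refine Finset.sum_congr rfl fun k _ => ?_
    linear_combination (catalan k : ZMod (p ^ 2)) * 5 ^ (p - 1 - k) * hsq k
  have hSc : ((∑ k ∈ range p, (-1) ^ k * wInt p k * catalan k * 5 ^ (p - 1 - k) : ℤ) :
      ZMod (p ^ 2)) = ∑ k ∈ range p, (wInt p k : ZMod (p ^ 2)) * catalan k
        * ((-1) ^ k * 5 ^ (p - 1 - k)) := by
    push_cast
    exact Finset.sum_congr rfl fun k _ => by ring
  have hBc : ∑ k ∈ range (p - 1), (chooseQuot p (k + 1) : ZMod (p ^ 2)) * catalan k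
        * ((-1) ^ k * 5 ^ (p - 1 - k))
      = ∑ k ∈ range (p - 1), (-1) ^ k * (chooseQuot p (k + 1) : ZMod (p ^ 2)) * catalan k
        * 5 ^ (p - 1 - k) :=
    Finset.sum_congr rfl fun k _ => by ring
  have h5m : (5 : ZMod (p ^ 2)) ^ (p - 1) = 5 ^ m * 5 ^ m := by
    rw [← pow_add]
    congr 1
    omega
  rw [hAc, hev, hS, hg, hBc] at hmain
  rw [hSc]
  apply_fun (Int.cast : ℤ → ZMod (p ^ 2)) at hη hφ hf ha hF hZ hq
  push_cast at hη hφ hf ha hF hZ hB hq hmain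
  rw [h5m] at hq ⊢
  simp only [mul_one, Nat.sub_self, pow_zero] at hmain
  refine algebra_five (p := (p : ZMod (p ^ 2))) (P := p * φ) (H := p * η)
    (z := p * ∑ j ∈ range m, (chooseQuot p (2 * (j + 1)) : ZMod (p ^ 2)))
    (x := Nat.fib p) (y := luc p) (a := Nat.fib (p + 1)) hpp ?_ ?_ ?_ ?_ ?_ ?_ ?_ ?_
    (isUnit_two p (by omega)) hφ hl hη ha hf hq ?_
  · linear_combination (φ : ZMod (p ^ 2)) * hpp
  · linear_combination (φ : ZMod (p ^ 2)) ^ 2 * hpp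
  · linear_combination (η : ZMod (p ^ 2)) * hpp
  · linear_combination (φ : ZMod (p ^ 2)) * η * hpp
  · linear_combination (η : ZMod (p ^ 2)) ^ 2 * hpp
  · linear_combination (φ : ZMod (p ^ 2))
      * (∑ j ∈ range m, (chooseQuot p (2 * (j + 1)) : ZMod (p ^ 2))) * hpp
  · linear_combination (η : ZMod (p ^ 2))
      * (∑ j ∈ range m, (chooseQuot p (2 * (j + 1)) : ZMod (p ^ 2))) * hpp
  · rcases he with h | h <;> rw [h] <;> simp
  · rw [hmain, hB]
    linear_combination 5 * 5 ^ m * hF - 5 * 5 ^ m * (Nat.fib p : ZMod (p ^ 2)) * hZ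

/-! ### The sums weighted by `k`, modulo `p` -/

theorem sum_range_cast_eq_sum_univ {p : ℕ} [NeZero p] {R : Type*} [AddCommMonoid R]
    (f : ZMod p → R) : ∑ n ∈ range p, f n = ∑ a, f a := by
  refine Finset.sum_nbij' (fun n => (n : ZMod p)) ZMod.val (by simp)
    (fun a _ => Finset.mem_range.2 a.val_lt) (fun n hn => ?_) (by simp) (fun _ _ => rfl)
  exact ZMod.val_cast_of_lt (Finset.mem_range.1 hn)

theorem sum_eval_eq_zero {p : ℕ} [Fact p.Prime] {P : (ZMod p)[X]} (hP : P.natDegree < p - 1) :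
    ∑ a, P.eval a = 0 := by
  simp only [eval_eq_sum_range]
  rw [Finset.sum_comm]
  refine Finset.sum_eq_zero fun i hi => ?_
  have hi := Finset.mem_range.1 hi
  rw [← Finset.mul_sum, FiniteField.sum_pow_lt_card_sub_one, mul_zero]
  rw [ZMod.card]
  omega

/-- Up to a constant invertible modulo `p` and a Catalan factor, the summand is a polynomial in `n`
of degree `2k+1 < p-1`, and such polynomials sum to zero over `ZMod p`. -/
theorem sum_sumCoeff_of_lt {p m k : ℕ} [hp : Fact p.Prime] (hm : p = 2 * m + 1) (hk : k < m) :
    ∑ n ∈ range p, (sumCoeff n k : ZMod p) = 0 := by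
  let P : (ZMod p)[X] := descPochhammer (ZMod p) (k + 1)
    * (descPochhammer (ZMod p) k).comp (X + C ((k : ZMod p) + 1))
  have hd : P.natDegree < p - 1 := by
    refine natDegree_mul_le.trans_lt ?_
    rw [natDegree_comp, natDegree_X_add_C, descPochhammer_natDegree, descPochhammer_natDegree]
    omega
  have hP : ∀ n : ℕ, P.eval (n : ZMod p)
      = ((k + 1).factorial : ZMod p) * k.factorial * (n.choose (k + 1) * (n + k + 1).choose k) := by
    intro n
    have e : (n : ZMod p) + ((k : ZMod p) + 1) = ((n + k + 1 : ℕ) : ZMod p) := by push_cast; ring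
    simp only [P, eval_mul, eval_comp, eval_add, eval_X, eval_C]
    rw [e, descPochhammer_eval_eq_descFactorial, descPochhammer_eval_eq_descFactorial,
      Nat.descFactorial_eq_factorial_mul_choose, Nat.descFactorial_eq_factorial_mul_choose]
    push_cast
    ring
  have hf : ((k + 1).factorial : ZMod p) * k.factorial ≠ 0 := by
    refine mul_ne_zero ?_ ?_ <;>
    · rw [Ne, ZMod.natCast_eq_zero_iff, hp.out.dvd_factorial]
      omega
  refine (mul_eq_zero_iff_left hf).1 ?_
  have := sum_eval_eq_zero hd
  rw [← sum_range_cast_eq_sum_univ] at this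
  rw [← mul_zero (catalan k : ZMod p), ← this, mul_comm (_ * _ : ZMod p), Finset.sum_mul, Finset.mul_sum]
  refine Finset.sum_congr rfl fun n _ => ?_
  rw [hP, sumCoeff]
  push_cast
  ring

theorem cast_sumCoeff_of_gt {p m k n : ℕ} [hp : Fact p.Prime] (hm : p = 2 * m + 1) (hk : m < k)
    (hn : n < p) : (sumCoeff n k : ZMod p) = 0 := by
  rcases le_or_gt n k with h | h
  · rw [sumCoeff_eq_zero h, Nat.cast_zero]
  · have h1 := neg_two_mul_cast_catalan hm (show k + 1 < p by omega)
    rw [Nat.choose_eq_zero_of_lt (show m + 1 < k + 1 by omega), Nat.cast_zero, mul_zero] at h1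
    have h2 : (2 : ZMod p) ≠ 0 := by
      exact_mod_cast cast_ne_zero_of_lt p two_ne_zero (by omega)
    rw [sumCoeff, Nat.cast_mul, (mul_eq_zero_iff_left (neg_ne_zero.2 h2)).1 h1, mul_zero]

/-- For `m < n < p-1` a carry makes `binom(n+m+1, m)` divisible by `p`, so only `n = p-1`
contributes. There the three factors are `(-1)^(m+1)`, `1` (Lucas' theorem) and `C_m ≡ 2(-1)^m`. -/
theorem sum_sumCoeff_middle {p m : ℕ} [hp : Fact p.Prime] (hm : p = 2 * m + 1) :
    ∑ n ∈ range p, (sumCoeff n m : ZMod p) = -2 := by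
  have hm0 : m ≠ 0 := fun h => hp.out.ne_one (by rw [hm, h])
  have h2 : (2 : ZMod p) ≠ 0 := by
    exact_mod_cast cast_ne_zero_of_lt p two_ne_zero (by omega)
  have hz : ∀ n < p - 1, (sumCoeff n m : ZMod p) = 0 := by
    intro n hn
    rcases le_or_gt n m with h | h
    · rw [sumCoeff_eq_zero h, Nat.cast_zero]
    · have : p ∣ (n + m + 1).choose m :=
        hp.out.dvd_choose (by omega) (by omega) (by omega)
      rw [ZMod.natCast_eq_zero_iff, sumCoeff]
      exact dvd_mul_of_dvd_left (dvd_mul_of_dvd_right this _) _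
  have hr : ∑ n ∈ range p, (sumCoeff n m : ZMod p) = sumCoeff (p - 1) m := by
    obtain ⟨q, hq⟩ : ∃ q, p = q + 1 := ⟨p - 1, by have := hp.out.one_le; omega⟩
    have : range p = range (p - 1 + 1) := by congr 1; omega
    rw [this, Finset.sum_range_succ,
      Finset.sum_eq_zero (fun n hn => hz n (Finset.mem_range.1 hn)), zero_add]
  have h1 : ((p - 1).choose (m + 1) : ZMod p) = (-1) ^ (m + 1) :=
    cast_choose_prime_sub_one p (by omega)
  have h3 : ((p + m).choose m : ZMod p) = 1 := by
    have h := Choose.choose_modEq_choose_mod_mul_choose_div_nat (n := p + m) (k := m) (p := p)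
    rw [Nat.add_mod_left, Nat.mod_eq_of_lt (show m < p by omega), Nat.choose_self,
      Nat.div_eq_of_lt (show m < p by omega), Nat.choose_zero_right, mul_one] at h
    rw [(ZMod.natCast_eq_natCast_iff _ _ _).2 h, Nat.cast_one]
  have h4 := neg_two_mul_cast_catalan hm (show m + 1 < p by omega)
  have h5 : (2 : ZMod p) ^ (2 * m) = 1 := by
    rw [show 2 * m = p - 1 by omega, ZMod.pow_card_sub_one_eq_one h2]
  have h6 : (-4 : ZMod p) ^ m = (-1) ^ m := by
    rw [show (-4 : ZMod p) = -1 * 2 ^ 2 by norm_num, mul_pow, ← pow_mul, h5, mul_one]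
  have h7 : ((-1 : ZMod p) ^ m) * (-1) ^ m = 1 := by rw [← mul_pow]; simp
  rw [hr, sumCoeff, show p - 1 + m + 1 = p + m by omega]
  push_cast
  rw [h1, h3]
  rw [Nat.choose_self, pow_succ, h6] at h4
  refine mul_left_cancel₀ h2 ?_
  push_cast at h4
  rw [pow_succ]
  linear_combination (-1) ^ m * h4 - 4 * h7

theorem sum_sum_sumCoeff {p m : ℕ} [hp : Fact p.Prime] (hm : p = 2 * m + 1) (x : ZMod p) :
    ∑ n ∈ range p, ∑ k ∈ range n, (sumCoeff n k : ZMod p) * x ^ k = -2 * x ^ m := by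
  have h : ∀ n ∈ range p, ∑ k ∈ range n, (sumCoeff n k : ZMod p) * x ^ k
      = ∑ k ∈ range p, (sumCoeff n k : ZMod p) * x ^ k := fun n hn => by
    refine Finset.sum_subset (Finset.range_subset_range.2 (Finset.mem_range.1 hn).le)
      fun k _ hk => ?_
    rw [sumCoeff_eq_zero (by simpa using hk), Nat.cast_zero, zero_mul]
  rw [Finset.sum_congr rfl h, Finset.sum_comm]
  simp only [← Finset.sum_mul]
  rw [Finset.sum_eq_single_of_mem m (Finset.mem_range.2 (by omega)), sum_sumCoeff_middle hm]
  intro k _ hkm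
  rcases lt_or_gt_of_ne hkm with hk | hk
  · rw [sum_sumCoeff_of_lt hm hk, zero_mul]
  · rw [Finset.sum_eq_zero fun n hn => cast_sumCoeff_of_gt hm hk (Finset.mem_range.1 hn), zero_mul]

theorem sum_mul_eq_sub_sum_partial {R : Type*} [CommRing R] (t : ℕ → R) (N : ℕ) :
    ∑ k ∈ range N, (k : R) * t k
      = ((N : R) - 1) * ∑ k ∈ range N, t k - ∑ n ∈ range N, ∑ k ∈ range n, t k := by
  induction N with
  | zero => simp
  | succ N ih =>
    rw [Finset.sum_range_succ, Finset.sum_range_succ, Finset.sum_range_succ _ N, ih]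
    push_cast
    ring

/-- Clearing denominators gives an integer identity, which can then be carried into any field where
`d` is nonzero, in particular `ZMod p`. -/
theorem sum_T_mul_M_mul_pow {b c d : ℤ} (hd : d = b ^ 2 - 4 * c) (hd0 : d ≠ 0) (n : ℕ) :
    ∑ k ∈ range n, T k b c * M k b c * d ^ (n - k)
      = ∑ k ∈ range n, (sumCoeff n k : ℤ) * c ^ k * d ^ (n - k) := by
  have hdq : (d : ℚ) ≠ 0 := by exact_mod_cast hd0
  have h := congrArg (fun r : ℚ => (d : ℚ) ^ n * r) (sum_T_mul_M_div_pow hd hd0 n)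
  simp only [Finset.mul_sum] at h
  have e : ∀ k ∈ range n, (d : ℚ) ^ (n - k) = d ^ n / d ^ k := fun k hk => by
    rw [pow_sub₀ _ hdq (Finset.mem_range.1 hk).le, div_eq_mul_inv]
  have h' : ∑ k ∈ range n, (T k b c : ℚ) * M k b c * (d : ℚ) ^ (n - k)
      = ∑ k ∈ range n, (sumCoeff n k : ℚ) * (c : ℚ) ^ k * (d : ℚ) ^ (n - k) := by
    convert h using 1
    · exact Finset.sum_congr rfl fun k hk => by rw [e k hk]; ring
    · exact Finset.sum_congr rfl fun k hk => by rw [e k hk, div_pow]; ring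
  exact_mod_cast h'

theorem cast_sum_T_mul_M_div_pow {K : Type*} [Field K] {b c d : ℤ} (hd : d = b ^ 2 - 4 * c)
    (hd0 : (d : K) ≠ 0) (n : ℕ) :
    ∑ k ∈ range n, (T k b c : K) * M k b c / (d : K) ^ k
      = ∑ k ∈ range n, (sumCoeff n k : K) * ((c : K) / d) ^ k := by
  have hd0' : d ≠ 0 := fun h => hd0 (by rw [h, Int.cast_zero])
  have h := congrArg (Int.cast : ℤ → K) (sum_T_mul_M_mul_pow hd hd0' n)
  push_cast at h
  have e : ∀ k ∈ range n, (d : K) ^ (n - k) = d ^ n / d ^ k := fun k hk => by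
    rw [pow_sub₀ _ hd0 (Finset.mem_range.1 hk).le, div_eq_mul_inv]
  refine mul_left_cancel₀ (pow_ne_zero n hd0) ?_
  rw [Finset.mul_sum, Finset.mul_sum]
  convert h using 1
  · exact Finset.sum_congr rfl fun k hk => by rw [e k hk]; ring
  · exact Finset.sum_congr rfl fun k hk => by rw [e k hk, div_pow]; ring

theorem cast_sumCoeff_prime (p k : ℕ) [hp : Fact p.Prime] : (sumCoeff p k : ZMod p) = 0 := by
  have h := congrArg (Int.cast : ℤ → ZMod p) (sumCoeff_eq_mul_wInt p k hp.out.one_le)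
  push_cast at h
  rw [h, ZMod.natCast_self, zero_mul]

theorem cast_sum_mul_T_mul_M {p m : ℕ} [hp : Fact p.Prime] (hm : p = 2 * m + 1) {b c d : ℤ}
    (hd : d = b ^ 2 - 4 * c) (hd0 : (d : ZMod p) ≠ 0) :
    ((∑ k ∈ range p, (k : ℤ) * T k b c * M k b c * d ^ (p - k) : ℤ) : ZMod p)
      = d ^ p * (2 * ((c : ZMod p) / d) ^ m) := by
  have h := sum_mul_eq_sub_sum_partial (fun k => (T k b c : ZMod p) * M k b c / (d : ZMod p) ^ k) p
  simp only [cast_sum_T_mul_M_div_pow hd hd0] at h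
  -- The full sum vanishes because each coefficient is a multiple of `p`; only the sum of partial
  -- sums remains.
  simp only [sum_sum_sumCoeff hm, cast_sumCoeff_prime, zero_mul, Finset.sum_const_zero] at h
  have e : ∀ k ∈ range p, (d : ZMod p) ^ (p - k) = d ^ p / d ^ k := fun k hk => by
    rw [pow_sub₀ _ hd0 (Finset.mem_range.1 hk).le, div_eq_mul_inv]
  rw [show (2 : ZMod p) * ((c : ZMod p) / d) ^ m = ((p : ZMod p) - 1) * 0 - -2 * (c / d) ^ m by ring,
    ← h, Finset.mul_sum]
  push_cast
  exact Finset.sum_congr rfl fun k hk => by rw [e k hk]; ring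

/-! ### From residue rings back to rational congruences -/

theorem congrModPow_of_mul {p m : ℕ} {x y : ℚ} {D z : ℤ} (hD : ¬ (p : ℤ) ∣ D)
    (h : (D : ℚ) * (x - y) = (p : ℚ) ^ m * z) : CongrModPow p m x y := by
  have hD0 : (D : ℚ) ≠ 0 := by
    intro h0
    exact hD (by rw [Int.cast_eq_zero.1 h0]; exact dvd_zero _)
  refine ⟨z / D, fun hd => hD ?_, ?_⟩
  · have h1 : (((z / D : ℚ).den : ℕ) : ℤ) ∣ D := by
      rw [← Rat.divInt_eq_div]
      exact Rat.den_dvd z D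
    exact (Int.natCast_dvd_natCast.2 hd).trans h1
  · field_simp
    linear_combination h

theorem not_dvd_two_mul_five_pow {p : ℕ} (hp : p.Prime) (h2 : p ≠ 2) (h5 : p ≠ 5) (n : ℕ) :
    ¬ (p : ℤ) ∣ 2 * 5 ^ n := by
  have hpi := Nat.prime_iff_prime_int.1 hp
  intro h
  rcases hpi.dvd_or_dvd h with h | h
  · exact h2 ((Nat.prime_dvd_prime_iff_eq hp Nat.prime_two).1 (by exact_mod_cast h))
  · have := hpi.dvd_of_dvd_pow h
    exact h5 ((Nat.prime_dvd_prime_iff_eq hp Nat.prime_five).1 (by exact_mod_cast this))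

theorem exists_eq_mul_of_cast_eq {n : ℕ} {a b : ℤ} (h : (a : ZMod n) = b) :
    ∃ z : ℤ, a - b = n * z := by
  rw [eq_comm, ZMod.intCast_eq_intCast_iff_dvd_sub] at h
  exact h

theorem sum_eq_div_pow (p : ℕ) (b c : ℤ) :
    (5 : ℚ) ^ p * ∑ k ∈ range p, (k : ℚ) * (T k b c : ℚ) * (M k b c : ℚ) / 5 ^ k
      = ((∑ k ∈ range p, (k : ℤ) * T k b c * M k b c * 5 ^ (p - k) : ℤ) : ℚ) := by
  push_cast
  rw [Finset.mul_sum]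
  refine Finset.sum_congr rfl fun k hk => ?_
  rw [pow_sub₀ _ (by norm_num) (Finset.mem_range.1 hk).le]
  ring

/-- Both sides carry an explicit factor `p`, which supplies the third power; the denominators `2`
and `5^n` are prime to `p`. -/
theorem congrModPow_three_of_cast_eq {p : ℕ} [hp : Fact p.Prime] (h2 : p ≠ 2) (h5 : p ≠ 5) {n : ℕ}
    {x y : ℚ} {S B : ℤ} (hx : 5 ^ n * x = p * S) (hy : 2 * 5 ^ n * y = p * B)
    (h : ((2 * S : ℤ) : ZMod (p ^ 2)) = B) : CongrModPow p 3 x y := by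
  obtain ⟨z, hz⟩ := exists_eq_mul_of_cast_eq h
  refine congrModPow_of_mul (z := z) (not_dvd_two_mul_five_pow hp.out h2 h5 n) ?_
  have hz' : 2 * (S : ℚ) - B = (p : ℚ) ^ 2 * z := by exact_mod_cast hz
  push_cast
  linear_combination 2 * hx - hy + (p : ℚ) * hz'

theorem congrModPow_sum_neg_one {p : ℕ} [hp : Fact p.Prime] (h2 : p ≠ 2) (h5 : p ≠ 5) :
    CongrModPow p 3 (∑ k ∈ range p, (T k 1 (-1) : ℚ) * (M k 1 (-1) : ℚ) / 5 ^ k)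
      ((p : ℚ) / 2 * (1 - (legendreSym 5 (p : ℤ) : ℚ))
        + (p : ℚ) ^ 2 / 2 * (5 - (legendreSym 5 (p : ℤ) : ℚ) - fermatQuotient p 5)
        + (p : ℚ) / 2 * (5 - 2 * (legendreSym 5 (p : ℤ) : ℚ)) * (Nat.fib (fibIndex p) : ℚ)) := by
  obtain ⟨m, hm⟩ := hp.out.odd_of_ne_two h2
  have hp0 : (p : ℚ) ≠ 0 := by exact_mod_cast hp.out.ne_zero
  obtain ⟨q, hq⟩ : ∃ q : ℤ, (5 : ℤ) ^ (p - 1) - 1 = p * q := by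
    refine exists_eq_mul_of_cast_eq ?_
    have h50 : (5 : ZMod p) ≠ 0 := by
      intro h
      have h' : ((5 : ℕ) : ZMod p) = 0 := by exact_mod_cast h
      rw [ZMod.natCast_eq_zero_iff] at h'
      exact h5 ((Nat.prime_dvd_prime_iff_eq hp.out Nat.prime_five).1 h')
    push_cast
    exact ZMod.pow_card_sub_one_eq_one h50
  have hfq : fermatQuotient p 5 = q := by
    have : (5 : ℚ) ^ (p - 1) - 1 = p * q := by exact_mod_cast hq
    rw [fermatQuotient, div_eq_iff hp0]
    push_cast
    linear_combination this
  have hx : (5 : ℚ) ^ (p - 1) * ∑ k ∈ range p, (T k 1 (-1) : ℚ) * (M k 1 (-1) : ℚ) / 5 ^ k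
      = p * ((∑ k ∈ range p, (-1) ^ k * wInt p k * catalan k * 5 ^ (p - 1 - k) : ℤ) : ℚ) := by
    rw [← sum_T_mul_M_neg_one p hp.out.one_le, Finset.mul_sum]
    refine Finset.sum_congr rfl fun k hk => ?_
    have hk := Finset.mem_range.1 hk
    rw [pow_sub₀ _ (by norm_num) (show k ≤ p - 1 by omega)]
    ring
  have h := two_mul_cast_sum_neg_one hm h5 (q := q) (by linear_combination hq)
  refine congrModPow_three_of_cast_eq h2 h5 hx
    (B := 5 ^ (p - 1) * ((1 - legendreSym 5 (p : ℤ)) + p * (5 - legendreSym 5 (p : ℤ) - q)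
      + (5 - 2 * legendreSym 5 (p : ℤ)) * Nat.fib (fibIndex p))) ?_ ?_
  · rw [hfq]
    push_cast
    ring
  · push_cast at h ⊢
    exact h

theorem congrModPow_sum_five {p : ℕ} [hp : Fact p.Prime] (h2 : p ≠ 2) (h5 : p ≠ 5) :
    CongrModPow p 3 (∑ k ∈ range p, (T k 5 5 : ℚ) * (M k 5 5 : ℚ) / 5 ^ k)
      (5 * (p : ℚ) / 2 * ((legendreSym 5 (p : ℤ) : ℚ) - 1)
        + (p : ℚ) ^ 2 / 2 * (5 * (legendreSym 5 (p : ℤ) : ℚ) - 1)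
        - 5 * (p : ℚ) / 2 * (1 + 2 * (legendreSym 5 (p : ℤ) : ℚ))
          * (Nat.fib (fibIndex p) : ℚ)) := by
  obtain ⟨m, hm⟩ := hp.out.odd_of_ne_two h2
  have h := two_mul_cast_sum_one hm h5
  refine congrModPow_three_of_cast_eq h2 h5 (n := 0)
    (S := ∑ k ∈ range p, wInt p k * catalan k)
    (B := 5 * (legendreSym 5 (p : ℤ) - 1) + p * (5 * legendreSym 5 (p : ℤ) - 1)
      - 5 * (1 + 2 * legendreSym 5 (p : ℤ)) * Nat.fib (fibIndex p)) ?_ ?_ ?_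
  · rw [sum_T_mul_M_five p hp.out.one_le, pow_zero, one_mul]
  · push_cast
    ring
  · push_cast at h ⊢
    exact h

theorem congrModPow_weighted_sums {p : ℕ} [hp : Fact p.Prime] (h2 : p ≠ 2) (h5 : p ≠ 5) :
    CongrModPow p 1
      ((legendreSym p (-5) : ℚ)
        * ∑ k ∈ range p, (k : ℚ) * (T k 1 (-1) : ℚ) * (M k 1 (-1) : ℚ) / 5 ^ k)
      (∑ k ∈ range p, (k : ℚ) * (T k 5 5 : ℚ) * (M k 5 5 : ℚ) / 5 ^ k) ∧
    CongrModPow p 1 (∑ k ∈ range p, (k : ℚ) * (T k 5 5 : ℚ) * (M k 5 5 : ℚ) / 5 ^ k) 2 := by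
  obtain ⟨m, hm⟩ := hp.out.odd_of_ne_two h2
  have h50 : (5 : ZMod p) ≠ 0 := by
    intro h
    have h' : ((5 : ℕ) : ZMod p) = 0 := by exact_mod_cast h
    rw [ZMod.natCast_eq_zero_iff] at h'
    exact h5 ((Nat.prime_dvd_prime_iff_eq hp.out Nat.prime_five).1 h')
  have h50' : ((5 : ℤ) : ZMod p) ≠ 0 := by exact_mod_cast h50
  have hD : ¬ (p : ℤ) ∣ 5 ^ p := fun h =>
    not_dvd_two_mul_five_pow hp.out h2 h5 p (dvd_mul_of_dvd_right h 2)
  have hA := cast_sum_mul_T_mul_M hm (b := 1) (c := -1) (d := 5) (by norm_num) h50'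
  have hB := cast_sum_mul_T_mul_M hm (b := 5) (c := 5) (d := 5) (by norm_num) h50'
  rw [div_self h50', one_pow] at hB
  -- Euler's criterion gives the symbol as `(-5)^m`, the inverse of `(c/d)^m` for the pair `(1,-1)`.
  have he : (legendreSym p (-5) : ZMod p) * (((-1 : ℤ) : ZMod p) / ((5 : ℤ) : ZMod p)) ^ m = 1 := by
    rw [legendreSym.eq_pow, show p / 2 = m by omega, ← mul_pow]
    push_cast
    rw [neg_mul, mul_div_cancel₀ _ h50, neg_neg, one_pow]
  constructor
  · obtain ⟨z, hz⟩ := exists_eq_mul_of_cast_eq (n := p)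
      (a := legendreSym p (-5) * ∑ k ∈ range p, (k : ℤ) * T k 1 (-1) * M k 1 (-1) * 5 ^ (p - k))
      (b := ∑ k ∈ range p, (k : ℤ) * T k 5 5 * M k 5 5 * 5 ^ (p - k)) (by
        rw [hB, Int.cast_mul, hA]
        linear_combination 2 * ((5 : ℤ) : ZMod p) ^ p * he)
    refine congrModPow_of_mul (D := 5 ^ p) (z := z) hD ?_
    have hz' := congrArg (Int.cast : ℤ → ℚ) hz
    rw [Int.cast_sub, Int.cast_mul, ← sum_eq_div_pow, ← sum_eq_div_pow] at hz'
    push_cast at hz' ⊢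
    linear_combination hz'
  · obtain ⟨z, hz⟩ := exists_eq_mul_of_cast_eq (n := p)
      (a := ∑ k ∈ range p, (k : ℤ) * T k 5 5 * M k 5 5 * 5 ^ (p - k))
      (b := 5 ^ p * 2) (by
        rw [hB]
        push_cast
        ring)
    refine congrModPow_of_mul (D := 5 ^ p) (z := z) hD ?_
    have hz' := congrArg (Int.cast : ℤ → ℚ) hz
    rw [Int.cast_sub, ← sum_eq_div_pow] at hz'
    push_cast at hz' ⊢
    linear_combination hz'

end TrinomialMotzkin

theorem corollary3p2 :
    (∀ n : ℕ, 1 ≤ n →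
      ((1 / (n : ℚ) * ∑ k ∈ Finset.range n,
            (TrinomialMotzkin.T k 1 (-1) : ℚ) * (TrinomialMotzkin.M k 1 (-1) : ℚ)
              * 5 ^ (n - 1 - k)
          = ∑ k ∈ Finset.Icc 1 n,
            (-1 : ℚ) ^ (k - 1) * TrinomialMotzkin.w n k * (catalan (k - 1) : ℚ) * 5 ^ (n - k))
        ∧ (∃ z : ℤ, ∑ k ∈ Finset.Icc 1 n,
            (-1 : ℚ) ^ (k - 1) * TrinomialMotzkin.w n k * (catalan (k - 1) : ℚ) * 5 ^ (n - k)
              = (z : ℚ)))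
      ∧ ((1 / (n : ℚ) * ∑ k ∈ Finset.range n,
            (TrinomialMotzkin.T k 5 5 : ℚ) * (TrinomialMotzkin.M k 5 5 : ℚ) / 5 ^ k
          = ∑ k ∈ Finset.Icc 1 n, TrinomialMotzkin.w n k * (catalan (k - 1) : ℚ))
        ∧ (∃ z : ℤ, ∑ k ∈ Finset.Icc 1 n, TrinomialMotzkin.w n k * (catalan (k - 1) : ℚ)
              = (z : ℚ))))
    ∧ (∀ (p : ℕ) [Fact p.Prime], p ≠ 2 → p ≠ 5 →
      TrinomialMotzkin.CongrModPow p 3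
        (∑ k ∈ Finset.range p,
          (TrinomialMotzkin.T k 1 (-1) : ℚ) * (TrinomialMotzkin.M k 1 (-1) : ℚ) / 5 ^ k)
        ((p : ℚ) / 2 * (1 - (legendreSym 5 (p : ℤ) : ℚ))
          + (p : ℚ) ^ 2 / 2
              * (5 - (legendreSym 5 (p : ℤ) : ℚ) - TrinomialMotzkin.fermatQuotient p 5)
          + (p : ℚ) / 2 * (5 - 2 * (legendreSym 5 (p : ℤ) : ℚ))
              * (Nat.fib (TrinomialMotzkin.fibIndex p) : ℚ))
      ∧ TrinomialMotzkin.CongrModPow p 3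
        (∑ k ∈ Finset.range p,
          (TrinomialMotzkin.T k 5 5 : ℚ) * (TrinomialMotzkin.M k 5 5 : ℚ) / 5 ^ k)
        (5 * (p : ℚ) / 2 * ((legendreSym 5 (p : ℤ) : ℚ) - 1)
          + (p : ℚ) ^ 2 / 2 * (5 * (legendreSym 5 (p : ℤ) : ℚ) - 1)
          - 5 * (p : ℚ) / 2 * (1 + 2 * (legendreSym 5 (p : ℤ) : ℚ))
              * (Nat.fib (TrinomialMotzkin.fibIndex p) : ℚ))
      ∧ TrinomialMotzkin.CongrModPow p 1
        ((legendreSym p (-5) : ℚ) * ∑ k ∈ Finset.range p,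
          (k : ℚ) * (TrinomialMotzkin.T k 1 (-1) : ℚ) * (TrinomialMotzkin.M k 1 (-1) : ℚ) / 5 ^ k)
        (∑ k ∈ Finset.range p,
          (k : ℚ) * (TrinomialMotzkin.T k 5 5 : ℚ) * (TrinomialMotzkin.M k 5 5 : ℚ) / 5 ^ k)
      ∧ TrinomialMotzkin.CongrModPow p 1
        (∑ k ∈ Finset.range p,
          (k : ℚ) * (TrinomialMotzkin.T k 5 5 : ℚ) * (TrinomialMotzkin.M k 5 5 : ℚ) / 5 ^ k)
        2) := by
  refine ⟨fun n hn => ?_, fun p _ h2 h5 => ?_⟩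
  · have hn0 : (n : ℚ) ≠ 0 := by exact_mod_cast (show n ≠ 0 by omega)
    refine ⟨⟨?_, _, TrinomialMotzkin.sum_neg_one_eq n hn⟩, ?_, _, TrinomialMotzkin.sum_one_eq n hn⟩
    · rw [TrinomialMotzkin.sum_neg_one_eq n hn, TrinomialMotzkin.sum_T_mul_M_neg_one n hn,
        ← mul_assoc, one_div_mul_cancel hn0, one_mul]
    · rw [TrinomialMotzkin.sum_one_eq n hn, TrinomialMotzkin.sum_T_mul_M_five n hn,
        ← mul_assoc, one_div_mul_cancel hn0, one_mul]
  · exact ⟨TrinomialMotzkin.congrModPow_sum_neg_one h2 h5,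
      TrinomialMotzkin.congrModPow_sum_five h2 h5,
      TrinomialMotzkin.congrModPow_weighted_sums h2 h5⟩
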